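/- **Proposition (asymptotic local self-similarity).** Let $(N,h)$ be any smooth $m$-dimensional Riemannian manifold without boundary, with Levi-Civita connection $\nabla$, and equip $\mathbf{R}^{1+2}$, with coordinates $(x^0,x^1,x^2)=(t,x)$, with the Minkowski metric $-dt^2+dx^2$, used to raise and lower indices. Let $\psi=(\psi_0,\psi_1,\psi_2)$, $\psi_\alpha:[-1,0)\times\mathbf{R}^2\to\mathbf{R}^m$, be a Schwartz derivative wave map on $[-1,0)\times\mathbf{R}^2$ with target $N$. That is, there are * a smooth map $\phi:[-1,0)\times\mathbf{R}^2\to N$ and a point $\phi(\infty)\in N$ such that for each fixed $t$, as $|x|\to\infty$, $\phi(t,x)$ converges to $\phi(\infty)$ faster than any negative power of $|x|$, and all spacetime derivatives of $\phi$ converge to zero faster than any negative power of $|x|$ (in local coordinates near $\phi(\infty)$), * a smooth orthonormal frame $e(t,x):\mathbf{R}^m\to T_{\phi(t,x)}N$ of $\phi^*(TN)$, and * $m\times m$ matrix-valued functions $A_\alpha$ on $[-1,0)\times\mathbf{R}^2$, such that on $[-1,0)\times\mathbf{R}^2$, for $\alpha=0,1,2$, $$\partial_\alpha\phi=e\,\psi_\alpha,\qquad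 (\phi^*\nabla)_\alpha e=e\,A_\alpha,\qquad D^\alpha\psi_\alpha=0,\quad\text{where } D_\alpha:=\partial_\alpha+A_\alpha.$$ (Equivalently, $\phi$ is a Schwartz wave map and $\psi_\alpha=e^{-1}\partial_\alpha\phi$. No symmetry is assumed.) Let $\psi_S:=x^\alpha\psi_\alpha=t\psi_0+x_1\psi_1+x_2\psi_2$ be the component of $\psi$ along the scaling field $S=x^\alpha\partial_\alpha$, so that $\frac1t\psi_S=\psi_0+\frac{x_j}{t}\psi_j$. Then for every $-1<T<0$ the function $\frac1t\left|\frac1t\psi_S(t,x)\right|^2$ is integrable on the truncated cone $\{-1\le t\le T,\ |x|<|t|\}$, and $$\lim_{T\to0^-}\frac{1}{|\log|T||}\int_{-1}^{T}\int_{|x|<|t|}\Big|\frac1t\psi_S(t,x)\Big|^2\,dx\,\frac{dt}{t}=0.$$ -/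

import Mathlib

open Set Filter Topology MeasureTheory
open scoped Manifold ContDiff

noncomputable section

namespace WaveMap

/-- `ℝ^m` with its Euclidean inner product. -/
abbrev Euc (m : ℕ) : Type := EuclideanSpace ℝ (Fin m)

/-- The spacetime `ℝ^{1+2}` with coordinates `(t, x)`. -/
abbrev Spacetime : Type := ℝ × Euc 2

/-- The slab `[-1, 0) × ℝ²`. -/
def slab : Set Spacetime := Ico (-1 : ℝ) 0 ×ˢ univ

/-- The coordinate vectors `∂_0 = ∂_t`, `∂_1`, `∂_2` of spacetime. -/
def coordVec : Fin 3 → Spacetime :=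
  ![(1, 0), (0, EuclideanSpace.single 0 1), (0, EuclideanSpace.single 1 1)]

/-- The diagonal entries of the Minkowski metric `-dt² + dx²` (it is its own inverse). -/
def minkowski : Fin 3 → ℝ := ![-1, 1, 1]

/-- The partial derivative `∂_α f` of a vector-valued function on the slab
(one-sided in time at `t = -1`). -/
def pderiv {F : Type*} [NormedAddCommGroup F] [NormedSpace ℝ F]
    (α : Fin 3) (f : Spacetime → F) (p : Spacetime) : F :=
  fderivWithin ℝ f slab p (coordVec α)

section Target

variable {m : ℕ} {N : Type*} [TopologicalSpace N] [ChartedSpace (Euc m) N]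

/-- Smooth Riemannian metrics on the `m`-dimensional manifold `N`. -/
abbrev RiemMetric (m : ℕ) (N : Type*) [TopologicalSpace N] [ChartedSpace (Euc m) N]
    [IsManifold (𝓡 m) ∞ N] : Type _ :=
  Bundle.ContMDiffRiemannianMetric (𝓡 m) ∞ (Euc m) (fun x : N => TangentSpace (𝓡 m) x)

/-- The partial derivative `∂_α φ`, a vector field along `φ`. -/
def mapDeriv (φ : Spacetime → N) (α : Fin 3) (p : Spacetime) : TangentSpace (𝓡 m) (φ p) :=
  mfderivWithin 𝓘(ℝ, Spacetime) (𝓡 m) φ slab p (coordVec α)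

/-- The tangent vector at `y` with components `v` in the coordinates given by the chart at `q`. -/
def ofCoord (q : N) (y : Euc m) (v : Euc m) :
    TangentSpace (𝓡 m) ((extChartAt (𝓡 m) q).symm y) :=
  mfderiv 𝓘(ℝ, Euc m) (𝓡 m) (extChartAt (𝓡 m) q).symm y v

/-- The components, in the coordinates given by the chart at `q`, of a tangent vector at `z`. -/
def toCoord (q z : N) (v : TangentSpace (𝓡 m) z) : Euc m :=
  mfderiv (𝓡 m) 𝓘(ℝ, Euc m) (extChartAt (𝓡 m) q) z v

variable [IsManifold (𝓡 m) ∞ N]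

/-- The matrix `h_{ab}` of the metric in the coordinates given by the chart at `q`. -/
def gram (h : RiemMetric m N) (q : N) (y : Euc m) : Matrix (Fin m) (Fin m) ℝ :=
  Matrix.of fun a b => h.inner ((extChartAt (𝓡 m) q).symm y)
    (ofCoord q y (EuclideanSpace.single a 1)) (ofCoord q y (EuclideanSpace.single b 1))

/-- The Christoffel symbols
`Γ^a_{bc} = ½ h^{ad} (∂_b h_{dc} + ∂_c h_{db} - ∂_d h_{bc})` of the Levi-Civita connection
in the coordinates given by the chart at `q`. -/
def christoffel (h : RiemMetric m N) (q : N) (y : Euc m) (a b c : Fin m) : ℝ :=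
  (1 / 2) * ∑ d, (gram h q y)⁻¹ a d *
    (fderiv ℝ (fun z => gram h q z d c) y (EuclideanSpace.single b 1)
      + fderiv ℝ (fun z => gram h q z d b) y (EuclideanSpace.single c 1)
      - fderiv ℝ (fun z => gram h q z b c) y (EuclideanSpace.single d 1))

/-- The pull-back Levi-Civita derivative `(φ^*∇)_α V` of a vector field `V` along `φ`. At `p` it is
computed in the chart `(φ^a)` at `φ p`, where its components are
`∂_α V^a + Γ^a_{bc}(φ) ∂_α φ^b V^c`. Mathlib's `TangentSpace (𝓡 m) q` is by definition the space of
components in the chart at `q`, so these components are the tangent vector itself. -/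
def covDeriv (h : RiemMetric m N) (φ : Spacetime → N)
    (V : ∀ p, TangentSpace (𝓡 m) (φ p)) (α : Fin 3) (p : Spacetime) :
    TangentSpace (𝓡 m) (φ p) :=
  (WithLp.toLp 2 fun a : Fin m =>
    pderiv α (fun p' => toCoord (φ p) (φ p') (V p') a) p
      + ∑ b, ∑ c, christoffel h (φ p) (extChartAt (𝓡 m) (φ p) (φ p)) a b c
          * pderiv α (fun p' => extChartAt (𝓡 m) (φ p) (φ p') b) p
          * toCoord (φ p) (φ p) (V p) c : Euc m)

/-- `φ` is smooth on the slab and, at each time, decays at spatial infinity to a point `φ(∞)`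
faster than any power of `|x|`, together with all its (spacetime) derivatives; since `φ(t, x)`
lies near `φ(∞)` for large `x`, this is expressed in the chart at `φ(∞)`. -/
structure IsSchwartzMap (φ : Spacetime → N) : Prop where
  smooth : ContMDiffOn 𝓘(ℝ, Spacetime) (𝓡 m) ∞ φ slab
  decay : ∃ φinf : N, ∀ t ∈ Ico (-1 : ℝ) 0,
    Tendsto (fun x : Euc 2 => φ (t, x)) (cocompact (Euc 2)) (𝓝 φinf) ∧
    ∀ n k : ℕ, Tendsto (fun x : Euc 2 => ‖x‖ ^ k *
      ‖iteratedFDerivWithin ℝ n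
        (fun p => extChartAt (𝓡 m) φinf (φ p) - extChartAt (𝓡 m) φinf φinf) slab (t, x)‖)
      (cocompact (Euc 2)) (𝓝 0)

/-- `e = (e_1, …, e_m)` is a smooth orthonormal frame of `φ^*(TN)` over the slab. -/
structure IsOrthonormalFrame (h : RiemMetric m N) (φ : Spacetime → N)
    (e : Fin m → ∀ p, TangentSpace (𝓡 m) (φ p)) : Prop where
  smooth : ∀ i, ContMDiffOn 𝓘(ℝ, Spacetime) (𝓡 m).tangent ∞
    (fun p => (⟨φ p, e i p⟩ : TangentBundle (𝓡 m) N)) slab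
  orthonormal : ∀ p ∈ slab, ∀ i j, h.inner (φ p) (e i p) (e j p) = if i = j then 1 else 0

/-- The covariant derivative `D_α f = ∂_α f + A_α f` of an `ℝ^m`-valued function. -/
def gaugeDeriv (A : Fin 3 → Spacetime → Matrix (Fin m) (Fin m) ℝ) (α : Fin 3)
    (f : Spacetime → Euc m) (p : Spacetime) : Euc m :=
  pderiv α f p + WithLp.toLp 2 ((A α p).mulVec (f p))

/-- `ψ` is a Schwartz derivative wave map on `[-1, 0) × ℝ²` with target `(N, h)`: there are a
Schwartz map `φ` into `N`, a smooth orthonormal frame `e` along it, and connection coefficients `A`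
with `∂_α φ = e ψ_α`, `(φ^*∇)_α e = e A_α` and `D^α ψ_α = 0`. (The skew-symmetry of `A`, the zero
torsion identity and the curvature identity are consequences of the first two equations.) -/
def IsSchwartzDerivativeWaveMap (h : RiemMetric m N) (ψ : Fin 3 → Spacetime → Euc m) : Prop :=
  ∃ (φ : Spacetime → N) (e : Fin m → ∀ p, TangentSpace (𝓡 m) (φ p))
    (A : Fin 3 → Spacetime → Matrix (Fin m) (Fin m) ℝ),
    IsSchwartzMap (m := m) φ ∧ IsOrthonormalFrame h φ e ∧
    (∀ p ∈ slab, ∀ α, mapDeriv φ α p = ∑ i, ψ α p i • e i p) ∧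
    (∀ p ∈ slab, ∀ α i, covDeriv h φ (e i) α p = ∑ j, A α p j i • e j p) ∧
    (∀ p ∈ slab, ∑ α, minkowski α • gaugeDeriv A α (ψ α) p = 0)

end Target

/-- The component `ψ_S = S^α ψ_α = t ψ_0 + x_j ψ_j` along the scaling field `S = x^α ∂_α`. -/
def scalingComponent {m : ℕ} (ψ : Fin 3 → Spacetime → Euc m) (p : Spacetime) : Euc m :=
  p.1 • ψ 0 p + p.2 0 • ψ 1 p + p.2 1 • ψ 2 p

end WaveMap

end

/-!
Since the connection is metric and torsion free, `ψ` solves the gauge-covariant div-curl system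
`D^α ψ_α = 0`, `D_α ψ_β = D_β ψ_α`, and so its stress-energy tensor `T` is divergence free.

Contracting `T` with `∂_t` shows that the energy in the slice of the light cone at time `t` is at
most the energy `E` at time `-1`, hence `∫∫ T_00 / |t| ≤ E |log |T||`. Contracting instead with
`(2 / δ) ∂_t + w S`, where `w = ((1 + δ²) t² - |x|²)^{-1/2}`, gives a current whose flux through the
cone is outgoing and whose divergence is `w³ |ψ_S|²` up to an error of order `δ T_00 / |t|`. As
`w ≥ 1 / (2 |t|)` in the cone, this bounds `∫∫ |t|⁻¹ |ψ_S / t|²` by a multiple of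
`E (1 / δ + δ |log |T||)`, which is `o(|log |T||)` for `δ = |log |T||^{-1/2}`.
-/

noncomputable section

namespace WaveMap

lemma uniqueDiffOn_slab : UniqueDiffOn ℝ slab :=
  (uniqueDiffOn_Ico _ _).prod uniqueDiffOn_univ

lemma pderiv_eq_fderiv {F : Type*} [NormedAddCommGroup F] [NormedSpace ℝ F] (α : Fin 3)
    (f : Spacetime → F) {p : Spacetime} (hp : slab ∈ 𝓝 p) :
    pderiv α f p = fderiv ℝ f p (coordVec α) := by
  rw [pderiv, fderivWithin_of_mem_nhds hp]

section Geometry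

variable {m : ℕ} {N : Type*} [TopologicalSpace N] [ChartedSpace (Euc m) N]

lemma toCoord_add (q z : N) (v w : TangentSpace (𝓡 m) z) :
    toCoord q z (v + w) = toCoord q z v + toCoord q z w :=
  map_add (mfderiv (𝓡 m) 𝓘(ℝ, Euc m) (extChartAt (𝓡 m) q) z) v w

lemma toCoord_sum_smul (q z : N) {ι : Type*} (s : Finset ι) (c : ι → ℝ)
    (v : ι → TangentSpace (𝓡 m) z) :
    toCoord q z (∑ i ∈ s, c i • v i) = ∑ i ∈ s, c i • toCoord q z (v i) := by
  simp only [toCoord]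
  rw [map_sum]
  exact Finset.sum_congr rfl fun i _ =>
    map_smul (mfderiv (𝓡 m) 𝓘(ℝ, Euc m) (extChartAt (𝓡 m) q) z) (c i) (v i)

lemma sum_smul_single (v : Euc m) : ∑ a, v a • EuclideanSpace.single a (1 : ℝ) = v := by
  ext b
  simp [Pi.single_apply]

variable [IsManifold (𝓡 m) ∞ N]

lemma toCoord_self (q : N) (v : TangentSpace (𝓡 m) q) : toCoord q q v = v :=
  DFunLike.congr_fun (mfderiv_extChartAt_self (I := 𝓡 m) (x := q)) v

lemma ofCoord_toCoord (q : N) {y : Euc m} (hy : y ∈ (extChartAt (𝓡 m) q).target)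
    (v : TangentSpace (𝓡 m) ((extChartAt (𝓡 m) q).symm y)) :
    ofCoord q y (toCoord q _ v) = v := by
  have h_comp := mfderivWithin_extChartAt_symm_comp_mfderiv_extChartAt (I := 𝓡 m) hy
  rw [ModelWithCorners.range_eq_univ, mfderivWithin_univ] at h_comp
  exact DFunLike.congr_fun h_comp v

lemma toCoord_ofCoord (q : N) {y : Euc m} (hy : y ∈ (extChartAt (𝓡 m) q).target) (v : Euc m) :
    toCoord q _ (ofCoord q y v) = v := by
  have h_comp := mfderiv_extChartAt_comp_mfderivWithin_extChartAt_symm (I := 𝓡 m) hy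
  rw [ModelWithCorners.range_eq_univ, mfderivWithin_univ] at h_comp
  exact DFunLike.congr_fun h_comp v

lemma contMDiffOn_ofCoord (q : N) (v : Euc m) :
    ContMDiffOn 𝓘(ℝ, Euc m) (𝓡 m).tangent ∞
      (fun y => (⟨(extChartAt (𝓡 m) q).symm y, ofCoord q y v⟩ : TangentBundle (𝓡 m) N))
      (extChartAt (𝓡 m) q).target := by
  have ho : IsOpen (extChartAt (𝓡 m) q).target := isOpen_extChartAt_target q
  have h_tangent := (contMDiffOn_extChartAt_symm (I := 𝓡 m) (n := ∞) q).contMDiffOn_tangentMapWithin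
    (m := ∞) (by simp) ho.uniqueDiffOn.uniqueMDiffOn
  have h_const : ContMDiff 𝓘(ℝ, Euc m) 𝓘(ℝ, Euc m).tangent ∞
      (fun p => (⟨p, v⟩ : TangentBundle 𝓘(ℝ, Euc m) (Euc m))) := fun _ =>
    contMDiffAt_vectorSpace_iff_contDiffAt.2 contDiffAt_const
  refine (h_tangent.comp h_const.contMDiffOn (fun p hp => hp)).congr fun y hy => ?_
  simp only [Function.comp, tangentMapWithin, ofCoord]
  rw [mfderivWithin_of_isOpen ho hy]

lemma contDiffOn_inner {E : Type*} [NormedAddCommGroup E] [NormedSpace ℝ E]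
    (h : RiemMetric m N) {f : E → N} {V W : ∀ x, TangentSpace (𝓡 m) (f x)} {s : Set E}
    (hV : ContMDiffOn 𝓘(ℝ, E) (𝓡 m).tangent ∞ (fun x => (⟨f x, V x⟩ : TangentBundle (𝓡 m) N)) s)
    (hW : ContMDiffOn 𝓘(ℝ, E) (𝓡 m).tangent ∞ (fun x => (⟨f x, W x⟩ : TangentBundle (𝓡 m) N)) s) :
    ContDiffOn ℝ ∞ (fun x => h.inner (f x) (V x) (W x)) s := by
  intro x hx
  have hf : ContMDiffWithinAt 𝓘(ℝ, E) (𝓡 m) ∞ f s x :=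
    (Bundle.contMDiffWithinAt_totalSpace.1 (hV x hx)).1
  have h_pair : ContMDiffWithinAt 𝓘(ℝ, E) ((𝓡 m).prod 𝓘(ℝ)) ∞
      (fun x => Bundle.TotalSpace.mk' ℝ (E := Bundle.Trivial N ℝ) (f x)
        (h.inner (f x) (V x) (W x))) s x :=
    ContMDiffWithinAt.clm_bundle_apply₂ (F₁ := Euc m) (F₂ := Euc m)
      (h.contMDiff.contMDiffAt.comp_contMDiffWithinAt x hf) (hV x hx) (hW x hx)
  exact contMDiffWithinAt_iff_contDiffWithinAt.1 (Bundle.contMDiffWithinAt_totalSpace.1 h_pair).2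

/-- The metric in the coordinates given by the chart at `q`, as a bilinear form on `ℝ^m` depending
on the point `y` of the chart; its matrix is `gram h q y`. -/
def coordMetric (h : RiemMetric m N) (q : N) (y : Euc m) : Euc m →L[ℝ] Euc m →L[ℝ] ℝ :=
  let D : Euc m →L[ℝ] Euc m := mfderiv 𝓘(ℝ, Euc m) (𝓡 m) (extChartAt (𝓡 m) q).symm y
  let H : Euc m →L[ℝ] Euc m →L[ℝ] ℝ := h.inner ((extChartAt (𝓡 m) q).symm y)
  H.bilinearComp D D

variable (h : RiemMetric m N) (q : N)

lemma coordMetric_apply (y v w : Euc m) :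
    coordMetric h q y v w = h.inner _ (ofCoord q y v) (ofCoord q y w) := rfl

lemma coordMetric_symm (y v w : Euc m) : coordMetric h q y v w = coordMetric h q y w v :=
  h.symm _ _ _

lemma inner_eq_coordMetric {z : N} (hz : z ∈ (extChartAt (𝓡 m) q).source)
    (v w : TangentSpace (𝓡 m) z) :
    h.inner z v w
      = coordMetric h q (extChartAt (𝓡 m) q z) (toCoord q z v) (toCoord q z w) := by
  obtain ⟨y, hy, rfl⟩ : ∃ y ∈ (extChartAt (𝓡 m) q).target, (extChartAt (𝓡 m) q).symm y = z :=
    ⟨_, (extChartAt (𝓡 m) q).map_source hz, (extChartAt (𝓡 m) q).left_inv hz⟩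
  rw [(extChartAt (𝓡 m) q).right_inv hy, coordMetric_apply, ofCoord_toCoord q hy,
    ofCoord_toCoord q hy]

lemma contDiffOn_coordMetric :
    ContDiffOn ℝ ∞ (coordMetric h q) (extChartAt (𝓡 m) q).target :=
  contDiffOn_clm_apply.2 fun v => contDiffOn_clm_apply.2 fun w => by
    simp only [coordMetric_apply]
    exact contDiffOn_inner h (contMDiffOn_ofCoord q v) (contMDiffOn_ofCoord q w)

/-- The Christoffel symbols as a bilinear map: `Γ(u, v)^a = Γ^a_{bc} u^b v^c`. -/
def christoffelMap (y u v : Euc m) : Euc m :=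
  WithLp.toLp 2 fun a => ∑ b, ∑ c, christoffel h q y a b c * u b * v c

lemma christoffelMap_symm (y u v : Euc m) :
    christoffelMap h q y u v = christoffelMap h q y v u := by
  have h_symm : ∀ a b c, christoffel h q y a b c = christoffel h q y a c b := by
    intro a b c
    have h_gram : (fun z => gram h q z b c) = fun z => gram h q z c b :=
      funext fun z => h.symm _ _ _
    simp only [christoffel, h_gram, add_comm (fderiv ℝ (fun z => gram h q z _ c) y _)]
  ext a
  simp only [christoffelMap]
  rw [Finset.sum_comm]
  refine Finset.sum_congr rfl fun c _ => Finset.sum_congr rfl fun b _ => ?_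
  rw [h_symm a b c]
  ring

lemma christoffelMap_sum_smul {ι : Type*} (s : Finset ι) (y u : Euc m) (c : ι → ℝ) (v : ι → Euc m) :
    christoffelMap h q y u (∑ i ∈ s, c i • v i)
      = ∑ i ∈ s, c i • christoffelMap h q y u (v i) := by
  ext a
  simp only [christoffelMap, WithLp.ofLp_sum, WithLp.ofLp_smul, Finset.sum_apply, Pi.smul_apply,
    smul_eq_mul, Finset.mul_sum]
  rw [Finset.sum_comm_cycle]
  exact Finset.sum_congr rfl fun i _ => Finset.sum_congr rfl fun b _ =>
    Finset.sum_congr rfl fun d _ => by ring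

/-- The linear form `w ↦ (∂_u g)(v, w) + (∂_v g)(u, w) - (∂_w g)(u, v)`, which is twice the lowered
Christoffel symbol `g(Γ(u, v), w)`. -/
def koszulForm (y u v : Euc m) : Euc m →L[ℝ] ℝ :=
  fderiv ℝ (coordMetric h q) y u v + fderiv ℝ (coordMetric h q) y v u
    - ((fderiv ℝ (coordMetric h q) y).flip u).flip v

lemma koszulForm_apply (y u v w : Euc m) :
    koszulForm h q y u v w = fderiv ℝ (coordMetric h q) y u v w
      + fderiv ℝ (coordMetric h q) y v u w - fderiv ℝ (coordMetric h q) y w u v := rfl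

lemma koszulForm_eq_sum (y u v w : Euc m) :
    koszulForm h q y u v w = ∑ b, ∑ c,
      koszulForm h q y (EuclideanSpace.single b 1) (EuclideanSpace.single c 1) w * u b * v c := by
  simp only [koszulForm_apply]
  conv_lhs => rw [← sum_smul_single u, ← sum_smul_single v]
  simp only [map_sum, map_smul, sum_apply, smul_apply, smul_eq_mul, Finset.mul_sum]
  rw [Finset.sum_comm, ← Finset.sum_add_distrib, Finset.sum_comm (γ := Fin m),
    ← Finset.sum_sub_distrib]
  refine Finset.sum_congr rfl fun b _ => ?_
  rw [← Finset.sum_add_distrib, ← Finset.sum_sub_distrib]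
  exact Finset.sum_congr rfl fun c _ => by ring

variable {q} {y : Euc m} (hy : y ∈ (extChartAt (𝓡 m) q).target)
include hy

lemma coordMetric_pos {v : Euc m} (hv : v ≠ 0) : 0 < coordMetric h q y v v := by
  rw [coordMetric_apply]
  refine h.pos _ (ofCoord q y v) fun h_zero => hv ?_
  have h_left_inv := toCoord_ofCoord q hy v
  rw [h_zero] at h_left_inv
  exact h_left_inv.symm.trans (map_zero (mfderiv (𝓡 m) 𝓘(ℝ, Euc m) (extChartAt (𝓡 m) q) _))

lemma isUnit_det_gram : IsUnit (gram h q y).det := by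
  rw [isUnit_iff_ne_zero]
  intro h_det
  obtain ⟨v, hv, hv'⟩ := Matrix.exists_mulVec_eq_zero_iff.2 h_det
  have h_row : ∀ a, coordMetric h q y (EuclideanSpace.single a 1) (WithLp.toLp 2 v) = 0 := by
    refine fun a => Eq.trans ?_ (congrFun hv' a)
    rw [← sum_smul_single (WithLp.toLp 2 v), map_sum]
    refine Finset.sum_congr rfl fun b _ => ?_
    rw [map_smul, smul_eq_mul, mul_comm]
    rfl
  refine (coordMetric_pos h hy (v := WithLp.toLp 2 v) (by simpa using hv)).ne' ?_
  conv_lhs => arg 1; rw [← sum_smul_single (WithLp.toLp 2 v)]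
  simp [h_row]

lemma differentiableAt_coordMetric : DifferentiableAt ℝ (coordMetric h q) y :=
  ((contDiffOn_coordMetric h q).contDiffAt
    ((isOpen_extChartAt_target q).mem_nhds hy)).differentiableAt (by simp)

lemma fderiv_coordMetric_apply (u v w : Euc m) :
    fderiv ℝ (fun z => coordMetric h q z v w) y u = fderiv ℝ (coordMetric h q) y u v w := by
  have h_apply := ((differentiableAt_coordMetric h hy).hasFDerivAt.clm_apply
    (hasFDerivAt_const v y)).clm_apply (hasFDerivAt_const w y)
  rw [h_apply.fderiv]
  simp

lemma fderiv_coordMetric_symm (u v w : Euc m) :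
    fderiv ℝ (coordMetric h q) y u v w = fderiv ℝ (coordMetric h q) y u w v := by
  simp only [← fderiv_coordMetric_apply h hy, coordMetric_symm h q _ v w]

lemma christoffelMap_apply (u v : Euc m) (a : Fin m) :
    christoffelMap h q y u v a
      = (1 / 2) * ∑ d, (gram h q y)⁻¹ a d * koszulForm h q y u v (EuclideanSpace.single d 1) := by
  have h_gram : ∀ b c w, fderiv ℝ (fun z => gram h q z b c) y w = fderiv ℝ (coordMetric h q) y w
      (EuclideanSpace.single b 1) (EuclideanSpace.single c 1) := fun b c w =>
    fderiv_coordMetric_apply h hy w _ _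
  have h_koszul : ∀ b c d, fderiv ℝ (fun z => gram h q z d c) y (EuclideanSpace.single b 1)
      + fderiv ℝ (fun z => gram h q z d b) y (EuclideanSpace.single c 1)
      - fderiv ℝ (fun z => gram h q z b c) y (EuclideanSpace.single d 1)
      = koszulForm h q y (EuclideanSpace.single b 1) (EuclideanSpace.single c 1)
        (EuclideanSpace.single d 1) := by
    intro b c d
    rw [h_gram, h_gram, h_gram, koszulForm_apply, fderiv_coordMetric_symm h hy _ _
      (EuclideanSpace.single c 1), fderiv_coordMetric_symm h hy _ _ (EuclideanSpace.single b 1)]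
  simp only [christoffelMap, christoffel, h_koszul, koszulForm_eq_sum h q y u v, Finset.mul_sum,
    Finset.sum_mul]
  rw [Finset.sum_comm_cycle]
  exact Finset.sum_congr rfl fun d _ => Finset.sum_congr rfl fun b _ =>
    Finset.sum_congr rfl fun c _ => by ring

lemma coordMetric_christoffelMap (u v w : Euc m) :
    coordMetric h q y (christoffelMap h q y u v) w = (1 / 2) * koszulForm h q y u v w := by
  have h_inv : ∀ b d, ∑ a, gram h q y b a * (gram h q y)⁻¹ a d = if b = d then 1 else 0 := by
    intro b d
    rw [← Matrix.one_apply, ← Matrix.mul_nonsing_inv _ (isUnit_det_gram h hy), Matrix.mul_apply]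
  have h_basis : ∀ b, coordMetric h q y (christoffelMap h q y u v) (EuclideanSpace.single b 1)
      = (1 / 2) * koszulForm h q y u v (EuclideanSpace.single b 1) := by
    intro b
    calc coordMetric h q y (christoffelMap h q y u v) (EuclideanSpace.single b 1)
        = ∑ a, gram h q y b a * christoffelMap h q y u v a := by
          rw [coordMetric_symm]
          conv_lhs => rw [← sum_smul_single (christoffelMap h q y u v)]
          simp only [map_sum, map_smul, smul_eq_mul]
          exact Finset.sum_congr rfl fun a _ => mul_comm _ _
      _ = (1 / 2) * ∑ d, (∑ a, gram h q y b a * (gram h q y)⁻¹ a d)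
            * koszulForm h q y u v (EuclideanSpace.single d 1) := by
          simp only [christoffelMap_apply h hy, Finset.mul_sum, Finset.sum_mul]
          rw [Finset.sum_comm]
          exact Finset.sum_congr rfl fun d _ => Finset.sum_congr rfl fun a _ => by ring
      _ = (1 / 2) * koszulForm h q y u v (EuclideanSpace.single b 1) := by simp [h_inv]
  rw [← sum_smul_single w]
  simp only [map_sum, map_smul, h_basis, smul_eq_mul, Finset.mul_sum]
  exact Finset.sum_congr rfl fun b _ => by ring

lemma fderiv_coordMetric (u v w : Euc m) :
    fderiv ℝ (coordMetric h q) y u v w = coordMetric h q y (christoffelMap h q y u v) w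
      + coordMetric h q y v (christoffelMap h q y u w) := by
  rw [coordMetric_symm h q y v, coordMetric_christoffelMap h hy, coordMetric_christoffelMap h hy,
    koszulForm_apply, koszulForm_apply,
    fderiv_coordMetric_symm h hy u w v, fderiv_coordMetric_symm h hy v u w,
    fderiv_coordMetric_symm h hy w u v]
  ring

end Geometry

section FieldsAlongMaps

variable {m : ℕ} {N : Type*} [TopologicalSpace N] [ChartedSpace (Euc m) N]
  [IsManifold (𝓡 m) ∞ N] {φ : Spacetime → N} {V W : ∀ p, TangentSpace (𝓡 m) (φ p)}

/-- `V` is a smooth section of `φ^*(TN)` over the slab; in particular `φ` itself is smooth. -/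
def SmoothAlong (φ : Spacetime → N) (V : ∀ p, TangentSpace (𝓡 m) (φ p)) : Prop :=
  ContMDiffOn 𝓘(ℝ, Spacetime) (𝓡 m).tangent ∞
    (fun p => (⟨φ p, V p⟩ : TangentBundle (𝓡 m) N)) slab

lemma smoothAlong_mapDeriv (hφ : ContMDiffOn 𝓘(ℝ, Spacetime) (𝓡 m) ∞ φ slab) (α : Fin 3) :
    SmoothAlong φ (mapDeriv (m := m) φ α) := by
  have h_tangent := hφ.contMDiffOn_tangentMapWithin (m := ∞) (by simp)
    uniqueDiffOn_slab.uniqueMDiffOn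
  have h_const : ContMDiff 𝓘(ℝ, Spacetime) 𝓘(ℝ, Spacetime).tangent ∞
      (fun p => (⟨p, coordVec α⟩ : TangentBundle 𝓘(ℝ, Spacetime) Spacetime)) := fun _ =>
    contMDiffAt_vectorSpace_iff_contDiffAt.2 contDiffAt_const
  exact h_tangent.comp h_const.contMDiffOn fun p hp => hp

lemma toCoord_mapDeriv {p : Spacetime} (q : N) (hp : slab ∈ 𝓝 p)
    (hφ : MDifferentiableAt 𝓘(ℝ, Spacetime) (𝓡 m) φ p)
    (hq : φ p ∈ (extChartAt (𝓡 m) q).source) (α : Fin 3) :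
    toCoord q (φ p) (mapDeriv φ α p)
      = fderiv ℝ (fun p' => extChartAt (𝓡 m) q (φ p')) p (coordVec α) := by
  have h_chart : MDifferentiableAt (𝓡 m) 𝓘(ℝ, Euc m) (extChartAt (𝓡 m) q) (φ p) :=
    mdifferentiableAt_extChartAt (by rwa [extChartAt_source] at hq)
  rw [mapDeriv, mfderivWithin_of_mem_nhds hp, ← mfderiv_eq_fderiv]
  exact (DFunLike.congr_fun (mfderiv_comp p h_chart hφ) (coordVec α)).symm

lemma covDeriv_congr (h : RiemMetric m N) (hVW : ∀ p ∈ slab, V p = W p) (α : Fin 3)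
    {p : Spacetime} (hp : p ∈ slab) : covDeriv h φ V α p = covDeriv h φ W α p := by
  have h_pderiv : ∀ a, pderiv α (fun p' => toCoord (φ p) (φ p') (V p') a) p
      = pderiv α (fun p' => toCoord (φ p) (φ p') (W p') a) p := fun a => by
    rw [pderiv, fderivWithin_congr' (fun p' hp' => by rw [hVW p' hp']) hp, pderiv]
  simp only [covDeriv, h_pderiv, hVW p hp]
  rfl

namespace SmoothAlong

variable {p : Spacetime}

lemma contMDiffAt_base (hV : SmoothAlong φ V) (hp : slab ∈ 𝓝 p) :
    ContMDiffAt 𝓘(ℝ, Spacetime) (𝓡 m) ∞ φ p :=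
  (Bundle.contMDiffAt_totalSpace.1 (hV.contMDiffAt hp)).1

lemma eventually_mem_source (hV : SmoothAlong φ V) (hp : slab ∈ 𝓝 p) :
    ∀ᶠ p' in 𝓝 p, φ p' ∈ (extChartAt (𝓡 m) (φ p)).source :=
  (hV.contMDiffAt_base hp).continuousAt.preimage_mem_nhds (extChartAt_source_mem_nhds (φ p))

lemma contDiffAt_chart (hV : SmoothAlong φ V) (hp : slab ∈ 𝓝 p) :
    ContDiffAt ℝ ∞ (fun p' => extChartAt (𝓡 m) (φ p) (φ p')) p :=
  contMDiffAt_iff_contDiffAt.1 (contMDiffAt_extChartAt.comp p (hV.contMDiffAt_base hp))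

lemma differentiableAt_toCoord (hV : SmoothAlong φ V) (hp : slab ∈ 𝓝 p) :
    DifferentiableAt ℝ (fun p' => toCoord (φ p) (φ p') (V p')) p := by
  obtain ⟨h_base, h_fiber⟩ := Bundle.contMDiffAt_totalSpace.1 (hV.contMDiffAt hp)
  have h_triv : ContMDiffAt 𝓘(ℝ, Spacetime) 𝓘(ℝ, Euc m) ∞
      (fun p' => toCoord (φ p) (φ p') (V p')) p := by
    refine h_fiber.congr_of_eventuallyEq ?_
    filter_upwards [h_base.continuousAt.preimage_mem_nhds
      (chart_source_mem_nhds (Euc m) (φ p))] with p' hp'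
    have h_mfderiv := DFunLike.congr_fun
      (TangentBundle.continuousLinearMapAt_trivializationAt (I := 𝓡 m) (x₀ := φ p) hp') (V p')
    refine h_mfderiv.symm.trans ?_
    rw [Bundle.Trivialization.continuousLinearMapAt_apply,
      Bundle.Trivialization.coe_linearMapAt_of_mem]
    exact hp'
  exact (contMDiffAt_iff_contDiffAt.1 h_triv).differentiableAt (by simp)

lemma fderiv_chart (hV : SmoothAlong φ V) (hp : slab ∈ 𝓝 p) (α : Fin 3) :
    fderiv ℝ (fun p' => extChartAt (𝓡 m) (φ p) (φ p')) p (coordVec α)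
      = toCoord (φ p) (φ p) (mapDeriv φ α p) :=
  (toCoord_mapDeriv (φ p) hp ((hV.contMDiffAt_base hp).mdifferentiableAt (by simp))
    (mem_extChartAt_source (φ p)) α).symm

variable (h : RiemMetric m N)

lemma toCoord_covDeriv (hV : SmoothAlong φ V) (hp : slab ∈ 𝓝 p) (α : Fin 3) :
    toCoord (φ p) (φ p) (covDeriv h φ V α p)
      = fderiv ℝ (fun p' => toCoord (φ p) (φ p') (V p')) p (coordVec α)
        + christoffelMap h (φ p) (extChartAt (𝓡 m) (φ p) (φ p))
          (toCoord (φ p) (φ p) (mapDeriv φ α p)) (toCoord (φ p) (φ p) (V p)) := by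
  have h_coord : ∀ {f : Spacetime → Euc m}, DifferentiableAt ℝ f p → ∀ a,
      pderiv α (fun p' => f p' a) p = fderiv ℝ f p (coordVec α) a := fun hf a => by
    rw [pderiv_eq_fderiv _ _ hp]
    exact DFunLike.congr_fun
      ((EuclideanSpace.proj a : Euc m →L[ℝ] ℝ).hasFDerivAt.comp p hf.hasFDerivAt).fderiv _
  have h_chart := (hV.contDiffAt_chart hp).differentiableAt (by simp)
  rw [toCoord_self]
  refine PiLp.ext fun a => ?_
  simp only [covDeriv, h_coord (hV.differentiableAt_toCoord hp), h_coord h_chart,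
    hV.fderiv_chart hp]
  rfl

theorem fderiv_inner (hV : SmoothAlong φ V) (hW : SmoothAlong φ W) (hp : slab ∈ 𝓝 p)
    (α : Fin 3) :
    fderiv ℝ (fun p' => h.inner (φ p') (V p') (W p')) p (coordVec α)
      = h.inner (φ p) (covDeriv h φ V α p) (W p) + h.inner (φ p) (V p) (covDeriv h φ W α p) := by
  have h_local : (fun p' => h.inner (φ p') (V p') (W p')) =ᶠ[𝓝 p] fun p' =>
      coordMetric h (φ p) (extChartAt (𝓡 m) (φ p) (φ p')) (toCoord (φ p) (φ p') (V p'))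
        (toCoord (φ p) (φ p') (W p')) := by
    filter_upwards [hV.eventually_mem_source hp] with p' hp'
    exact inner_eq_coordMetric h (φ p) hp' _ _
  have h_target : extChartAt (𝓡 m) (φ p) (φ p) ∈ (extChartAt (𝓡 m) (φ p)).target :=
    mem_extChartAt_target (φ p)
  have h_chart := ((hV.contDiffAt_chart hp).differentiableAt (by simp)).hasFDerivAt
  have h_metric : HasFDerivAt
      (fun p' => coordMetric h (φ p) (extChartAt (𝓡 m) (φ p) (φ p'))) _ p :=
    HasFDerivAt.comp p (g := coordMetric h (φ p))
      (f := fun p' => extChartAt (𝓡 m) (φ p) (φ p'))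
      (differentiableAt_coordMetric h h_target).hasFDerivAt h_chart
  have h_deriv := (h_metric.clm_apply (hV.differentiableAt_toCoord hp).hasFDerivAt).clm_apply
    (hW.differentiableAt_toCoord hp).hasFDerivAt
  rw [h_local.fderiv_eq, h_deriv.fderiv]
  simp only [inner_eq_coordMetric h (φ p) (mem_extChartAt_source (φ p)),
    hV.toCoord_covDeriv h hp, hW.toCoord_covDeriv h hp, add_apply,
    ContinuousLinearMap.comp_apply, ContinuousLinearMap.flip_apply,
    hV.fderiv_chart hp, fderiv_coordMetric h h_target, map_add]
  ring

theorem covDeriv_sum_smul {ι : Type*} [Fintype ι] {e : ι → ∀ p, TangentSpace (𝓡 m) (φ p)}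
    (he : ∀ i, SmoothAlong φ (e i)) {f : ι → Spacetime → ℝ}
    (hV : SmoothAlong φ fun p' => ∑ i, f i p' • e i p')
    (hf : ∀ i, DifferentiableAt ℝ (f i) p) (hp : slab ∈ 𝓝 p) (α : Fin 3) :
    covDeriv h φ (fun p' => ∑ i, f i p' • e i p') α p
      = ∑ i, (fderiv ℝ (f i) p (coordVec α) • e i p + f i p • covDeriv h φ (e i) α p) := by
  have h_sum : HasFDerivAt (fun p' => ∑ i, f i p' • toCoord (φ p) (φ p') (e i p')) _ p :=
    HasFDerivAt.fun_sum fun i _ =>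
      (hf i).hasFDerivAt.smul ((he i).differentiableAt_toCoord hp).hasFDerivAt
  rw [Finset.sum_add_distrib, ← toCoord_self (φ p) (covDeriv h φ _ α p),
    ← toCoord_self (φ p) (_ + _), toCoord_add, toCoord_sum_smul, toCoord_sum_smul,
    hV.toCoord_covDeriv h hp]
  simp only [toCoord_sum_smul, h_sum.fderiv, christoffelMap_sum_smul,
    (he _).toCoord_covDeriv h hp, smul_add, Finset.sum_add_distrib, sum_apply, add_apply,
    smul_apply, ContinuousLinearMap.smulRight_apply]
  abel

end SmoothAlong

theorem covDeriv_mapDeriv_comm (h : RiemMetric m N) {p : Spacetime}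
    (hφ : ContMDiffOn 𝓘(ℝ, Spacetime) (𝓡 m) ∞ φ slab) (hp : slab ∈ 𝓝 p) (α β : Fin 3) :
    covDeriv h φ (mapDeriv φ β) α p = covDeriv h φ (mapDeriv φ α) β p := by
  set y : Spacetime → Euc m := fun p' => extChartAt (𝓡 m) (φ p) (φ p')
  have h_smooth := smoothAlong_mapDeriv hφ
  have h_chart : ContDiffAt ℝ ∞ y p := (h_smooth α).contDiffAt_chart hp
  have h_coord : ∀ γ, (fun p' => toCoord (φ p) (φ p') (mapDeriv φ γ p'))
      =ᶠ[𝓝 p] fun p' => fderiv ℝ y p' (coordVec γ) := by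
    intro γ
    filter_upwards [eventually_mem_nhds_iff.2 hp, (h_smooth α).eventually_mem_source hp]
      with p' hp' h_source
    exact toCoord_mapDeriv (φ p) hp' ((hφ.contMDiffAt hp').mdifferentiableAt (by simp)) h_source γ
  have h_second : ∀ γ δ, fderiv ℝ (fun p' => fderiv ℝ y p' (coordVec δ)) p (coordVec γ)
      = fderiv ℝ (fderiv ℝ y) p (coordVec γ) (coordVec δ) := by
    intro γ δ
    have h_diff : DifferentiableAt ℝ (fderiv ℝ y) p :=
      (h_chart.fderiv_right (m := 1) (by norm_cast)).differentiableAt (by simp)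
    rw [(h_diff.hasFDerivAt.clm_apply (hasFDerivAt_const (coordVec δ) p)).fderiv]
    simp
  have h_symm : IsSymmSndFDerivAt ℝ y p := h_chart.isSymmSndFDerivAt (by simp; norm_cast)
  rw [← toCoord_self (φ p) (covDeriv h φ (mapDeriv φ β) α p),
    ← toCoord_self (φ p) (covDeriv h φ (mapDeriv φ α) β p),
    (h_smooth β).toCoord_covDeriv h hp, (h_smooth α).toCoord_covDeriv h hp, (h_coord α).fderiv_eq,
    (h_coord β).fderiv_eq, h_second, h_second, h_symm.eq, christoffelMap_symm]

end FieldsAlongMaps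

section Frames

variable {m : ℕ} {N : Type*} [TopologicalSpace N] [ChartedSpace (Euc m) N]
  [IsManifold (𝓡 m) ∞ N] {h : RiemMetric m N} {φ : Spacetime → N}
  {e : Fin m → ∀ p, TangentSpace (𝓡 m) (φ p)}

lemma IsOrthonormalFrame.inner_sum_smul_left (he : IsOrthonormalFrame h φ e) {p : Spacetime}
    (hp : p ∈ slab) (u : Fin m → ℝ) (j : Fin m) :
    h.inner (φ p) (∑ i, u i • e i p) (e j p) = u j := by
  rw [map_sum, sum_apply]
  simp only [map_smul, smul_apply, he.orthonormal p hp, smul_eq_mul, mul_ite, mul_one, mul_zero,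
    Finset.sum_ite_eq', Finset.mem_univ, if_true]

lemma IsOrthonormalFrame.inner_sum_smul (he : IsOrthonormalFrame h φ e) {p : Spacetime}
    (hp : p ∈ slab) (u v : Euc m) :
    h.inner (φ p) (∑ i, u i • e i p) (∑ i, v i • e i p) = inner ℝ u v := by
  rw [map_sum]
  simp only [map_smul, he.inner_sum_smul_left hp, PiLp.inner_apply, RCLike.inner_apply,
    conj_trivial, smul_eq_mul]

lemma IsOrthonormalFrame.sum_smul_injective (he : IsOrthonormalFrame h φ e) {p : Spacetime}
    (hp : p ∈ slab) : Function.Injective fun u : Euc m => ∑ i, u i • e i p := by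
  intro u v (huv : ∑ i, u i • e i p = ∑ i, v i • e i p)
  ext j
  rw [← he.inner_sum_smul_left hp u, huv, he.inner_sum_smul_left hp]

/-- `ψ` is a derivative wave map: it represents the derivatives of the smooth map `φ` in the
orthonormal frame `e` of `φ^*(TN)`, whose connection coefficients are `A`. Unlike in
`IsSchwartzDerivativeWaveMap`, nothing is assumed about `φ` at spatial infinity. -/
structure IsDerivativeWaveMap (h : RiemMetric m N) (φ : Spacetime → N)
    (e : Fin m → ∀ p, TangentSpace (𝓡 m) (φ p))
    (A : Fin 3 → Spacetime → Matrix (Fin m) (Fin m) ℝ) (ψ : Fin 3 → Spacetime → Euc m) : Prop where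
  smooth : ContMDiffOn 𝓘(ℝ, Spacetime) (𝓡 m) ∞ φ slab
  frame : IsOrthonormalFrame h φ e
  mapDeriv_eq : ∀ p ∈ slab, ∀ α, mapDeriv φ α p = ∑ i, ψ α p i • e i p
  covDeriv_eq : ∀ p ∈ slab, ∀ α i, covDeriv h φ (e i) α p = ∑ j, A α p j i • e j p
  wave : ∀ p ∈ slab, ∑ α, minkowski α • gaugeDeriv A α (ψ α) p = 0

/-- The covariant div-curl system satisfied by a derivative wave map, in the form in which it
enters the energy estimates: `D α β` stands for the covariant derivative `D_α ψ_β`, and the only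
property of the connection that is retained is its compatibility with the inner product. -/
structure CovariantDivCurl {F : Type*} [NormedAddCommGroup F] [InnerProductSpace ℝ F]
    (ψ : Fin 3 → Spacetime → F) (D : Fin 3 → Fin 3 → Spacetime → F) : Prop where
  contDiffOn : ∀ α, ContDiffOn ℝ ∞ (ψ α) slab
  curl : ∀ p, slab ∈ 𝓝 p → ∀ α β, D α β p = D β α p
  div : ∀ p, slab ∈ 𝓝 p → ∑ α, minkowski α • D α α p = 0
  fderiv_inner : ∀ p, slab ∈ 𝓝 p → ∀ α β γ,
    fderiv ℝ (fun p => inner ℝ (ψ α p) (ψ β p)) p (coordVec γ)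
      = inner ℝ (D γ α p) (ψ β p) + inner ℝ (ψ α p) (D γ β p)

namespace IsDerivativeWaveMap

variable {A : Fin 3 → Spacetime → Matrix (Fin m) (Fin m) ℝ} {ψ : Fin 3 → Spacetime → Euc m}

lemma contDiffOn (hψ : IsDerivativeWaveMap h φ e A ψ) (α : Fin 3) :
    ContDiffOn ℝ ∞ (ψ α) slab :=
  contDiffOn_euclidean.2 fun i =>
    (contDiffOn_inner h (smoothAlong_mapDeriv hψ.smooth α) (hψ.frame.smooth i)).congr fun p hp => by
      rw [hψ.mapDeriv_eq p hp, hψ.frame.inner_sum_smul_left hp]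

lemma covDeriv_mapDeriv (hψ : IsDerivativeWaveMap h φ e A ψ) {p : Spacetime} (hp : slab ∈ 𝓝 p)
    (α β : Fin 3) :
    covDeriv h φ (mapDeriv φ β) α p = ∑ j, gaugeDeriv A α (ψ β) p j • e j p := by
  have h_slab := mem_of_mem_nhds hp
  have h_diff : DifferentiableAt ℝ (ψ β) p :=
    ((hψ.contDiffOn β).contDiffAt hp).differentiableAt (by simp)
  have h_smooth : SmoothAlong φ fun p' => ∑ i, ψ β p' i • e i p' :=
    (smoothAlong_mapDeriv hψ.smooth β).congr fun p' hp' => by rw [hψ.mapDeriv_eq p' hp']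
  have h_coord : ∀ j, gaugeDeriv A α (ψ β) p j
      = fderiv ℝ (fun p' => ψ β p' j) p (coordVec α) + ∑ i, A α p j i * ψ β p i := fun j => by
    rw [gaugeDeriv, pderiv_eq_fderiv _ _ hp, PiLp.add_apply]
    exact congrArg (· + _) (DFunLike.congr_fun
      ((EuclideanSpace.proj j : Euc m →L[ℝ] ℝ).hasFDerivAt.comp p h_diff.hasFDerivAt).fderiv _).symm
  rw [covDeriv_congr h (hψ.mapDeriv_eq · · β) α h_slab, SmoothAlong.covDeriv_sum_smul h
    hψ.frame.smooth h_smooth (differentiableAt_euclidean.1 h_diff) hp]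
  simp only [h_coord, hψ.covDeriv_eq p h_slab, add_smul, Finset.sum_add_distrib, Finset.smul_sum,
    Finset.sum_smul, smul_smul]
  rw [Finset.sum_comm]
  simp only [mul_comm]

theorem covariantDivCurl (hψ : IsDerivativeWaveMap h φ e A ψ) :
    CovariantDivCurl ψ fun α β => gaugeDeriv A α (ψ β) where
  contDiffOn := hψ.contDiffOn
  curl p hp α β := hψ.frame.sum_smul_injective (mem_of_mem_nhds hp) <| by
    simp only [← hψ.covDeriv_mapDeriv hp]
    exact covDeriv_mapDeriv_comm h hψ.smooth hp α β
  div p hp := hψ.wave p (mem_of_mem_nhds hp)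
  fderiv_inner p hp α β γ := by
    have h_slab := mem_of_mem_nhds hp
    have h_inner : (fun p' => inner ℝ (ψ α p') (ψ β p'))
        =ᶠ[𝓝 p] fun p' => h.inner (φ p') (mapDeriv φ α p') (mapDeriv φ β p') := by
      filter_upwards [hp] with p' hp'
      rw [hψ.mapDeriv_eq p' hp', hψ.mapDeriv_eq p' hp', hψ.frame.inner_sum_smul hp']
    rw [h_inner.fderiv_eq, (smoothAlong_mapDeriv hψ.smooth α).fderiv_inner h
      (smoothAlong_mapDeriv hψ.smooth β) hp, hψ.covDeriv_mapDeriv hp, hψ.covDeriv_mapDeriv hp,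
      hψ.mapDeriv_eq p h_slab, hψ.mapDeriv_eq p h_slab, hψ.frame.inner_sum_smul h_slab,
      hψ.frame.inner_sum_smul h_slab]

end IsDerivativeWaveMap

end Frames

section DivergenceTheorem

lemma hasDerivAt_integral_of_compact_support {X : Type*} [TopologicalSpace X] [T2Space X]
    [MeasurableSpace X] [OpensMeasurableSpace X] {μ : Measure X} [IsFiniteMeasureOnCompacts μ]
    {K : Set X} (hK : IsCompact K) {s : Set ℝ} (hs : IsOpen s) {f f' : ℝ → X → ℝ}
    (hf : ContinuousOn f.uncurry (s ×ˢ univ)) (hf' : ContinuousOn f'.uncurry (s ×ˢ univ))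
    (h_deriv : ∀ t ∈ s, ∀ x, HasDerivAt (f · x) (f' t x) t)
    (h_supp : ∀ t ∈ s, ∀ x ∉ K, f t x = 0) {t : ℝ} (ht : t ∈ s) :
    HasDerivAt (fun t => ∫ x, f t x ∂μ) (∫ x, f' t x ∂μ) t := by
  have h_supp' : ∀ t ∈ s, ∀ x ∉ K, f' t x = 0 := fun t ht x hx => by
    have h_zero : (f · x) =ᶠ[𝓝 t] fun _ => 0 := by
      filter_upwards [hs.mem_nhds ht] with t' ht' using h_supp t' ht' x hx
    exact (h_deriv t ht x).unique ((hasDerivAt_const t 0).congr_of_eventuallyEq h_zero)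
  have h_integrable : ∀ {g : ℝ → X → ℝ}, ContinuousOn g.uncurry (s ×ˢ univ) →
      (∀ t ∈ s, ∀ x ∉ K, g t x = 0) → ∀ t ∈ s, Integrable (g t) μ := fun hg h_supp t ht =>
    (hg.comp_continuous (by fun_prop : Continuous fun x => (t, x))
      fun _ => ⟨ht, mem_univ _⟩).integrable_of_hasCompactSupport
      (HasCompactSupport.intro hK fun x hx => h_supp t ht x hx)
  obtain ⟨k, hk, hkt, hks⟩ := exists_compact_subset hs ht
  obtain ⟨M, hM⟩ := (hk.prod hK).exists_bound_of_continuousOn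
    (hf'.mono (prod_mono hks (subset_univ _)))
  refine (hasDerivAt_integral_of_dominated_loc_of_deriv_le (s := k)
    (bound := K.indicator fun _ => M) (mem_interior_iff_mem_nhds.1 hkt) ?_
    (h_integrable hf h_supp t ht) (h_integrable hf' h_supp' t ht).aestronglyMeasurable ?_ ?_ ?_).2
  · filter_upwards [hs.mem_nhds ht] with t' ht'
    exact (h_integrable hf h_supp t' ht').aestronglyMeasurable
  · refine Eventually.of_forall fun x t' ht' => ?_
    by_cases hx : x ∈ K
    · rw [indicator_of_mem hx]
      exact hM (t', x) ⟨ht', hx⟩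
    · rw [indicator_of_notMem hx, h_supp' t' (hks ht') x hx, norm_zero]
  · exact (integrable_indicator_iff hK.measurableSet).2
      (integrableOn_const hK.measure_lt_top.ne)
  · exact Eventually.of_forall fun x t' ht' => h_deriv t' (hks ht') x

variable {E : Type*} [NormedAddCommGroup E] [NormedSpace ℝ E]

lemma fderiv_slice_apply {f : ℝ × E → ℝ} {t : ℝ} {x : E} (hf : DifferentiableAt ℝ f (t, x))
    (v : E) : fderiv ℝ (fun x => f (t, x)) x v = fderiv ℝ f (t, x) (0, v) :=
  DFunLike.congr_fun (hf.hasFDerivAt.comp x (hasFDerivAt_prodMk_right t x)).fderiv v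

variable [MeasurableSpace E] [BorelSpace E] {μ : Measure E}

lemma hasDerivAt_integral_slice [IsFiniteMeasureOnCompacts μ] {K : Set E} (hK : IsCompact K)
    {s : Set ℝ} (hs : IsOpen s) {f : ℝ × E → ℝ} (hf : ContDiffOn ℝ 1 f (s ×ˢ univ))
    (h_supp : ∀ t ∈ s, ∀ x ∉ K, f (t, x) = 0) {t : ℝ} (ht : t ∈ s) :
    HasDerivAt (fun t => ∫ x, f (t, x) ∂μ) (∫ x, fderiv ℝ f (t, x) (1, 0) ∂μ) t := by
  have h_open : IsOpen (s ×ˢ (univ : Set E)) := hs.prod isOpen_univ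
  refine hasDerivAt_integral_of_compact_support hK hs (f := fun t x => f (t, x))
    (f' := fun t x => fderiv ℝ f (t, x) (1, 0)) hf.continuousOn
    ((hf.continuousOn_fderiv_of_isOpen h_open le_rfl).clm_apply continuousOn_const)
    (fun t ht x => ?_) h_supp ht
  exact ((hf.contDiffAt (h_open.mem_nhds ⟨ht, mem_univ _⟩)).differentiableAt
    one_ne_zero).hasFDerivAt.comp_hasDerivAt t ((hasDerivAt_id t).prodMk (hasDerivAt_const t x))

variable [FiniteDimensional ℝ E] [μ.IsAddHaarMeasure]

lemma integral_fderiv_apply_eq_zero {g : E → ℝ} (hg : ContDiff ℝ 1 g)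
    (h_supp : HasCompactSupport g) (v : E) :
    Integrable (fun x => fderiv ℝ g x v) μ ∧ ∫ x, fderiv ℝ g x v ∂μ = 0 := by
  have h_integrable : Integrable (fun x => fderiv ℝ g x v) μ :=
    ((hg.continuous_fderiv one_ne_zero).clm_apply
      continuous_const).integrable_of_hasCompactSupport (h_supp.fderiv_apply (𝕜 := ℝ) v)
  have h_parts := integral_mul_fderiv_eq_neg_fderiv_mul_of_integrable (μ := μ)
    (f := fun _ => (1 : ℝ)) (g := g) (v := v) (by simp) (by simpa using h_integrable)
    (by simpa using hg.continuous.integrable_of_hasCompactSupport h_supp)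
    (fun _ _ => by fun_prop) (fun x _ => hg.differentiable one_ne_zero x)
  exact ⟨h_integrable, by simpa using h_parts⟩

lemma integral_spatial_fderiv_eq_zero {K : Set E} (hK : IsCompact K) {s : Set ℝ} (hs : IsOpen s)
    {f : ℝ × E → ℝ} (hf : ContDiffOn ℝ 1 f (s ×ˢ univ)) {t : ℝ} (ht : t ∈ s)
    (h_supp : ∀ x ∉ K, f (t, x) = 0) (v : E) :
    Integrable (fun x => fderiv ℝ f (t, x) (0, v)) μ ∧
      ∫ x, fderiv ℝ f (t, x) (0, v) ∂μ = 0 := by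
  have h_smooth : ContDiff ℝ 1 fun x => f (t, x) :=
    hf.comp_contDiff (contDiff_const.prodMk contDiff_id) fun x => ⟨ht, mem_univ _⟩
  have h_fderiv : ∀ x, fderiv ℝ f (t, x) (0, v) = fderiv ℝ (fun x => f (t, x)) x v := fun x =>
    (fderiv_slice_apply ((hf.contDiffAt ((hs.prod isOpen_univ).mem_nhds
      ⟨ht, mem_univ _⟩)).differentiableAt one_ne_zero) v).symm
  simp only [h_fderiv]
  exact integral_fderiv_apply_eq_zero h_smooth (HasCompactSupport.intro hK h_supp) v

/-- The divergence theorem on `[a, b] × E` for a current with density `ρ` and spatial components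
`j i` in the directions `v i`, compactly supported in space. -/
theorem integral_divergence_eq_sub {K : Set E} (hK : IsCompact K) {ι : Type*} [Fintype ι]
    (v : ι → E) {ρ R : ℝ × E → ℝ} {j : ι → ℝ × E → ℝ} {a b : ℝ} (hab : a ≤ b)
    (hρ : ContinuousOn ρ (Icc a b ×ˢ univ)) (hρ' : ContDiffOn ℝ 1 ρ (Ioo a b ×ˢ univ))
    (hj : ∀ i, ContDiffOn ℝ 1 (j i) (Ioo a b ×ˢ univ)) (hR : ContinuousOn R (Icc a b ×ˢ univ))
    (hρ_supp : ∀ t ∈ Icc a b, ∀ x ∉ K, ρ (t, x) = 0)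
    (hj_supp : ∀ i, ∀ t ∈ Ioo a b, ∀ x ∉ K, j i (t, x) = 0)
    (hR_supp : ∀ t ∈ Icc a b, ∀ x ∉ K, R (t, x) = 0)
    (h_div : ∀ t ∈ Ioo a b, ∀ x,
      fderiv ℝ ρ (t, x) (1, 0) + ∑ i, fderiv ℝ (j i) (t, x) (0, v i) = R (t, x)) :
    ∫ t in a..b, ∫ x, R (t, x) ∂μ = ∫ x, ρ (b, x) ∂μ - ∫ x, ρ (a, x) ∂μ := by
  have h_deriv : ∀ t ∈ Ioo a b,
      HasDerivAt (fun t => ∫ x, ρ (t, x) ∂μ) (∫ x, R (t, x) ∂μ) t := by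
    intro t ht
    have h_Icc := Ioo_subset_Icc_self ht
    have h_flux := fun i =>
      integral_spatial_fderiv_eq_zero (μ := μ) hK isOpen_Ioo (hj i) ht (hj_supp i t ht) (v i)
    have h_R : Integrable (fun x => R (t, x)) μ :=
      (hR.comp_continuous (by fun_prop : Continuous fun x : E => (t, x)) fun x =>
        ⟨h_Icc, mem_univ _⟩).integrable_of_hasCompactSupport
        (HasCompactSupport.intro hK (hR_supp t h_Icc))
    have h_integral : ∫ x, fderiv ℝ ρ (t, x) (1, 0) ∂μ = ∫ x, R (t, x) ∂μ := by
      simp only [fun x => eq_sub_of_add_eq (h_div t ht x)]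
      rw [integral_sub h_R (integrable_finsetSum _ fun i _ => (h_flux i).1),
        integral_finsetSum _ fun i _ => (h_flux i).1, Finset.sum_eq_zero fun i _ => (h_flux i).2,
        sub_zero]
    rw [← h_integral]
    exact hasDerivAt_integral_slice hK isOpen_Ioo hρ'
      (fun t ht => hρ_supp t (Ioo_subset_Icc_self ht)) ht
  exact intervalIntegral.integral_eq_sub_of_hasDerivAt_of_le hab
    (continuousOn_integral_of_compact_support (f := fun t x => ρ (t, x)) hK hρ
      fun t x ht hx => hρ_supp t ht x hx) h_deriv
    ((continuousOn_integral_of_compact_support (f := fun t x => R (t, x)) hK hR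
      fun t x ht hx => hR_supp t ht x hx).intervalIntegrable_of_Icc hab)

end DivergenceTheorem

lemma contDiffOn_mul_of_eventuallyEq_zero {E : Type*} [NormedAddCommGroup E] [NormedSpace ℝ E]
    {s U : Set E} (hU : IsOpen U) {f g : E → ℝ} {n : WithTop ℕ∞} (hf : ContDiffOn ℝ n f s)
    (hg : ContDiffOn ℝ n g (s ∩ U)) (h_zero : ∀ p ∈ s \ U, f =ᶠ[𝓝 p] 0) :
    ContDiffOn ℝ n (fun p => f p * g p) s := by
  intro p hp
  by_cases hpU : p ∈ U
  · exact (contDiffWithinAt_inter (hU.mem_nhds hpU)).1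
      ((hf.mono inter_subset_left).mul hg p ⟨hp, hpU⟩)
  · refine (contDiffWithinAt_const (c := 0)).congr_of_eventuallyEq_of_mem ?_ hp
    filter_upwards [nhdsWithin_le_nhds (h_zero p ⟨hp, hpU⟩)] with p' hp'
    simp only [hp', Pi.zero_apply, zero_mul]

lemma tendsto_setIntegral_mul_of_tendsto_one {X : Type*} [MeasurableSpace X] {μ : Measure X}
    {s : Set X} (hs : MeasurableSet s) {χ : ℕ → X → ℝ} (h_meas : ∀ n, Measurable (χ n))
    (h_bound : ∀ n, ∀ x, |χ n x| ≤ 1) (h_lim : ∀ x ∈ s, Tendsto (χ · x) atTop (𝓝 1)) {g : X → ℝ}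
    (hg : IntegrableOn g s μ) :
    Tendsto (fun n => ∫ x in s, χ n x * g x ∂μ) atTop (𝓝 (∫ x in s, g x ∂μ)) := by
  refine tendsto_integral_of_dominated_convergence (fun x => ‖g x‖)
    (fun n => (h_meas n).aestronglyMeasurable.mul hg.aestronglyMeasurable) hg.norm
    (fun n => Eventually.of_forall fun x => ?_) ?_
  · rw [norm_mul]
    exact mul_le_of_le_one_left (norm_nonneg _) (h_bound n x)
  · filter_upwards [ae_restrict_mem hs] with x hx
    simpa using (h_lim x hx).mul_const (g x)

section LightCone

lemma minkowski_mul_self (α : Fin 3) : minkowski α * minkowski α = 1 := by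
  fin_cases α <;> simp [minkowski]

/-- The coordinate functions `x^α`, which are also the components of the scaling field
`S = x^α ∂_α`. -/
def coord (α : Fin 3) (p : Spacetime) : ℝ := ![p.1, p.2 0, p.2 1] α

lemma contDiff_coord {n : WithTop ℕ∞} (α : Fin 3) : ContDiff ℝ n (coord α) := by
  fin_cases α
  · exact contDiff_fst
  · exact (EuclideanSpace.proj (𝕜 := ℝ) (0 : Fin 2)).contDiff.comp contDiff_snd
  · exact (EuclideanSpace.proj (𝕜 := ℝ) (1 : Fin 2)).contDiff.comp contDiff_snd

lemma fderiv_coord (α β : Fin 3) (p : Spacetime) :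
    fderiv ℝ (coord β) p (coordVec α) = if α = β then 1 else 0 := by
  have h_space : ∀ i : Fin 2, HasFDerivAt (fun p : Spacetime => p.2 i) _ p := fun i =>
    (EuclideanSpace.proj (𝕜 := ℝ) i).hasFDerivAt.comp p hasFDerivAt_snd
  have h_coord : ∀ β, HasFDerivAt (coord β) (![ContinuousLinearMap.fst ℝ ℝ (Euc 2),
      (EuclideanSpace.proj 0).comp (ContinuousLinearMap.snd ℝ ℝ (Euc 2)),
      (EuclideanSpace.proj 1).comp (ContinuousLinearMap.snd ℝ ℝ (Euc 2))] β) p :=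
    Fin.forall_fin_succ.2 ⟨hasFDerivAt_fst, Fin.forall_fin_two.2 ⟨h_space 0, h_space 1⟩⟩
  rw [(h_coord β).fderiv]
  fin_cases α <;> fin_cases β <;> simp [coordVec]

/-- The part in the slab of the closed solid backward light cone with apex at the origin. -/
def lightCone : Set Spacetime := {p | p ∈ slab ∧ ‖p.2‖ ≤ |p.1|}

/-- The part of the open solid light cone at times `-1 ≤ t ≤ T`. -/
def truncatedCone (T : ℝ) : Set Spacetime := {p | p.1 ∈ Icc (-1) T ∧ ‖p.2‖ < |p.1|}

lemma time_neg_of_mem_lightCone {p : Spacetime} (hp : p ∈ lightCone) : p.1 < 0 := hp.1.1.2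

lemma norm_sq_le_of_mem_lightCone {p : Spacetime} (hp : p ∈ lightCone) : ‖p.2‖ ^ 2 ≤ p.1 ^ 2 :=
  sq_le_sq.2 (by rw [abs_norm]; exact hp.2)

lemma coord_causal_of_mem_lightCone {p : Spacetime} (hp : p ∈ lightCone) :
    coord 1 p ^ 2 + coord 2 p ^ 2 ≤ coord 0 p ^ 2 := by
  have h_norm := norm_sq_le_of_mem_lightCone hp
  rwa [EuclideanSpace.real_norm_sq_eq, Fin.sum_univ_two] at h_norm

variable {T t : ℝ} {f : Spacetime → ℝ}

lemma measurableSet_truncatedCone (T : ℝ) : MeasurableSet (truncatedCone T) :=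
  (measurable_fst measurableSet_Icc).inter
    (isOpen_lt continuous_snd.norm continuous_fst.abs).measurableSet

lemma truncatedCone_subset_lightCone (hT : T < 0) : truncatedCone T ⊆ lightCone := fun _ hp =>
  ⟨⟨⟨hp.1.1, hp.1.2.trans_lt hT⟩, mem_univ _⟩, hp.2.le⟩

lemma mem_lightCone_of_mem_ball (ht : t ∈ Ico (-1 : ℝ) 0) {x : Euc 2}
    (hx : x ∈ Metric.ball 0 |t|) : (t, x) ∈ lightCone :=
  ⟨⟨ht, mem_univ _⟩, (mem_ball_zero_iff.1 hx).le⟩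

lemma integrableOn_truncatedCone (hf : ContinuousOn f lightCone) (hT : T < 0) :
    IntegrableOn f (truncatedCone T) := by
  have h_compact : IsCompact {p : Spacetime | p.1 ∈ Icc (-1) T ∧ ‖p.2‖ ≤ |p.1|} := by
    refine (isCompact_Icc.prod (isCompact_closedBall (0 : Euc 2) 1)).of_isClosed_subset
      ((isClosed_Icc.preimage continuous_fst).inter
        (isClosed_le continuous_snd.norm continuous_fst.abs)) fun p hp => ⟨hp.1, ?_⟩
    exact mem_closedBall_zero_iff.2
      (hp.2.trans (abs_le.2 ⟨hp.1.1, (hp.1.2.trans hT.le).trans zero_le_one⟩))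
  refine ((hf.mono fun p hp => ?_).integrableOn_compact h_compact).mono_set
    fun p hp => ⟨hp.1, hp.2.le⟩
  exact ⟨⟨⟨hp.1.1, hp.1.2.trans_lt hT⟩, mem_univ _⟩, hp.2⟩

lemma integrableOn_slice (hf : ContinuousOn f lightCone) (ht : t ∈ Ico (-1 : ℝ) 0) :
    IntegrableOn (fun x => f (t, x)) (Metric.ball 0 |t|) :=
  ((hf.comp (by fun_prop : Continuous fun x => (t, x)).continuousOn fun _ hx =>
    ⟨⟨ht, mem_univ _⟩, mem_closedBall_zero_iff.1 hx⟩).integrableOn_compact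
      (isCompact_closedBall 0 |t|)).mono_set Metric.ball_subset_closedBall

lemma setIntegral_truncatedCone (hT : -1 ≤ T) (hf : IntegrableOn f (truncatedCone T)) :
    ∫ p in truncatedCone T, f p = ∫ t in (-1)..T, ∫ x in Metric.ball 0 |t|, f (t, x) := by
  have h_slice : ∀ t x, (truncatedCone T).indicator f (t, x) = (Icc (-1) T).indicator
      (fun t => (Metric.ball 0 |t|).indicator (fun x => f (t, x)) x) t := by
    intro t x
    by_cases ht : t ∈ Icc (-1) T <;> by_cases hx : ‖x‖ < |t| <;>
      simp [indicator, truncatedCone, ht, hx, -mem_Icc]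
  have h_integrable := (integrable_indicator_iff (measurableSet_truncatedCone T)).2 hf
  rw [← integral_indicator (measurableSet_truncatedCone T), Measure.volume_eq_prod,
    integral_prod _ h_integrable, intervalIntegral.integral_of_le hT,
    ← integral_Icc_eq_integral_Ioc, ← integral_indicator measurableSet_Icc]
  refine integral_congr_ae (Eventually.of_forall fun t => ?_)
  by_cases ht : t ∈ Icc (-1) T
  · simp only [h_slice, indicator_of_mem ht, integral_indicator measurableSet_ball]
  · simp only [h_slice, indicator_of_notMem ht, integral_zero]

end LightCone

section Cutoff

/-- The quadratic form `a t² - |x|²` on spacetime; for `a = 1` it is minus the Minkowski form. -/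
def quadForm (a : ℝ) (p : Spacetime) : ℝ := a * p.1 ^ 2 - ‖p.2‖ ^ 2

lemma contDiff_quadForm {k : WithTop ℕ∞} (a : ℝ) : ContDiff ℝ k (quadForm a) :=
  (contDiff_const.mul (contDiff_fst.pow 2)).sub (contDiff_snd.norm_sq ℝ)

lemma fderiv_quadForm (a : ℝ) (p : Spacetime) (α : Fin 3) :
    fderiv ℝ (quadForm a) p (coordVec α) = 2 * ![a * p.1, -p.2 0, -p.2 1] α := by
  have h_fst : HasFDerivAt (fun p : Spacetime => a * p.1 ^ 2) _ p :=
    ((hasFDerivAt_fst (𝕜 := ℝ) (p := p)).pow 2).const_mul a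
  have h_snd : HasFDerivAt (fun p : Spacetime => ‖p.2‖ ^ 2) _ p := hasFDerivAt_snd.norm_sq
  have h_quad : HasFDerivAt (quadForm a) _ p := h_fst.sub h_snd
  rw [h_quad.fderiv]
  fin_cases α <;> simp [coordVec, EuclideanSpace.inner_single_right]
  ring

variable {n : ℕ} {p : Spacetime}

lemma quadForm_one_nonpos (hp : |p.1| ≤ ‖p.2‖) : quadForm 1 p ≤ 0 := by
  rw [quadForm, one_mul, sub_nonpos]
  exact sq_le_sq.2 (hp.trans (le_abs_self _))

lemma quadForm_one_pos (hp : ‖p.2‖ < |p.1|) : 0 < quadForm 1 p := by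
  rw [quadForm, one_mul, sub_pos]
  exact sq_lt_sq.2 (by rwa [abs_norm])

/-- A smooth cutoff supported in the solid cone `|x| ≤ |t|`, tending to `1` inside as `n → ∞`. -/
def cutoff (n : ℕ) (p : Spacetime) : ℝ := Real.smoothTransition (n * quadForm 1 p)

/-- The factor of proportionality between the gradient of `cutoff n` and minus the scaling
field. -/
def cutoffSlope (n : ℕ) (p : Spacetime) : ℝ :=
  2 * n * deriv Real.smoothTransition (n * quadForm 1 p)

lemma contDiff_cutoff {k : ℕ∞} (n : ℕ) : ContDiff ℝ k (cutoff n) :=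
  Real.smoothTransition.contDiff.comp (contDiff_const.mul (contDiff_quadForm 1))

lemma cutoff_eq_zero (hp : |p.1| ≤ ‖p.2‖) : cutoff n p = 0 :=
  Real.smoothTransition.zero_of_nonpos
    (mul_nonpos_of_nonneg_of_nonpos n.cast_nonneg (quadForm_one_nonpos hp))

lemma abs_cutoff_le_one (n : ℕ) (p : Spacetime) : |cutoff n p| ≤ 1 :=
  (abs_of_nonneg (Real.smoothTransition.nonneg _)).trans_le (Real.smoothTransition.le_one _)

lemma tendsto_cutoff (hp : ‖p.2‖ < |p.1|) : Tendsto (cutoff · p) atTop (𝓝 1) := by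
  have h_large := tendsto_natCast_atTop_atTop.atTop_mul_const (quadForm_one_pos hp)
  refine tendsto_const_nhds.congr' ?_
  filter_upwards [h_large.eventually_ge_atTop 1] with n hn
  exact (Real.smoothTransition.one_of_one_le hn).symm

lemma continuous_cutoffSlope (n : ℕ) : Continuous (cutoffSlope n) :=
  continuous_const.mul ((Real.smoothTransition.contDiff (n := 1).continuous_deriv le_rfl).comp
    (continuous_const.mul (contDiff_quadForm (k := 0) 1).continuous))

lemma cutoffSlope_nonneg (n : ℕ) (p : Spacetime) : 0 ≤ cutoffSlope n p :=
  mul_nonneg (by positivity) Real.smoothTransition.monotone.deriv_nonneg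

lemma fderiv_cutoff (n : ℕ) (p : Spacetime) (α : Fin 3) :
    fderiv ℝ (cutoff n) p (coordVec α) = -(minkowski α * cutoffSlope n p * coord α p) := by
  have h_quad := ((contDiff_quadForm (k := 1) 1).differentiable one_ne_zero p).hasFDerivAt
  have h_transition := ((Real.smoothTransition.contDiff (n := 1)).differentiable one_ne_zero
    (n * quadForm 1 p)).hasDerivAt
  have h_cutoff : HasFDerivAt (cutoff n) _ p :=
    h_transition.comp_hasFDerivAt p (h_quad.const_mul (n : ℝ))
  rw [h_cutoff.fderiv, smul_apply, smul_apply, fderiv_quadForm, cutoffSlope]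
  fin_cases α <;> simp [minkowski, coord] <;> ring

lemma eventually_abs_lt_norm (hp : |p.1| < ‖p.2‖) : ∀ᶠ p' : Spacetime in 𝓝 p, |p'.1| < ‖p'.2‖ :=
  (isOpen_lt continuous_fst.abs continuous_snd.norm).mem_nhds hp

lemma cutoff_eventuallyEq_zero (hp : |p.1| < ‖p.2‖) : cutoff n =ᶠ[𝓝 p] 0 :=
  (eventually_abs_lt_norm hp).mono fun _ hp' => cutoff_eq_zero hp'.le

lemma cutoffSlope_eq_zero (hp : |p.1| ≤ ‖p.2‖) : cutoffSlope n p = 0 := by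
  have h_min : IsLocalMin Real.smoothTransition (n * quadForm 1 p) :=
    Eventually.of_forall fun r => (cutoff_eq_zero hp).trans_le (Real.smoothTransition.nonneg r)
  rw [cutoffSlope, h_min.deriv_eq_zero, mul_zero]

lemma cutoffSlope_eventuallyEq_zero (hp : |p.1| < ‖p.2‖) : cutoffSlope n =ᶠ[𝓝 p] 0 :=
  (eventually_abs_lt_norm hp).mono fun _ hp' => cutoffSlope_eq_zero hp'.le

end Cutoff

section ConeInequality

variable {U : Set Spacetime} {J : Fin 3 → Spacetime → ℝ} {R : Spacetime → ℝ} {T : ℝ}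

lemma divergence_cutoff_mul {n : ℕ} {p : Spacetime} (hJ : ∀ α, DifferentiableAt ℝ (J α) p) :
    ∑ α, minkowski α * fderiv ℝ (fun p => cutoff n p * J α p) p (coordVec α)
      = cutoff n p * ∑ α, minkowski α * fderiv ℝ (J α) p (coordVec α)
        - cutoffSlope n p * ∑ α, coord α p * J α p := by
  have h_cutoff := (contDiff_cutoff (k := 1) n).differentiable one_ne_zero p
  rw [Finset.mul_sum, Finset.mul_sum, ← Finset.sum_sub_distrib]
  refine Finset.sum_congr rfl fun α _ => ?_
  rw [fderiv_fun_mul h_cutoff (hJ α), add_apply, smul_apply, smul_apply,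
    fderiv_cutoff, smul_eq_mul, smul_eq_mul]
  linear_combination -(J α p * cutoffSlope n p * coord α p) * minkowski_mul_self α

lemma divergence_cutoff_mul_of_divergence_eq {n : ℕ} (hU : IsOpen U) (hU_cone : lightCone ⊆ U)
    (hJ : ∀ α, ContDiffOn ℝ 1 (J α) (slab ∩ U))
    (h_div : ∀ p ∈ U, slab ∈ 𝓝 p → ∑ α, minkowski α * fderiv ℝ (J α) p (coordVec α) = R p)
    {p : Spacetime} (hp : slab ∈ 𝓝 p) :
    ∑ α, minkowski α * fderiv ℝ (fun p => cutoff n p * J α p) p (coordVec α)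
      = cutoff n p * R p - cutoffSlope n p * ∑ α, coord α p * J α p := by
  by_cases hpU : p ∈ U
  · rw [divergence_cutoff_mul fun α => ((hJ α).contDiffAt
      (inter_mem hp (hU.mem_nhds hpU))).differentiableAt one_ne_zero, h_div p hpU hp]
  · have hp_out : |p.1| < ‖p.2‖ := lt_of_not_ge fun h => hpU (hU_cone ⟨mem_of_mem_nhds hp, h⟩)
    have h_zero : ∀ α, (fun p => cutoff n p * J α p) =ᶠ[𝓝 p] fun _ => 0 := fun α =>
      (cutoff_eventuallyEq_zero (n := n) hp_out).mono fun _ h => mul_eq_zero_of_left h _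
    simp [(h_zero _).fderiv_eq, cutoff_eq_zero hp_out.le, cutoffSlope_eq_zero hp_out.le]

lemma contDiffOn_cutoff_mul {n : ℕ} {k : ℕ∞} (hU : IsOpen U) (hU_cone : lightCone ⊆ U)
    {g : Spacetime → ℝ} (hg : ContDiffOn ℝ k g (slab ∩ U)) :
    ContDiffOn ℝ k (fun p => cutoff n p * g p) slab :=
  contDiffOn_mul_of_eventuallyEq_zero hU (contDiff_cutoff n).contDiffOn hg fun _ hp =>
    cutoff_eventuallyEq_zero (lt_of_not_ge fun h => hp.2 (hU_cone ⟨hp.1, h⟩))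

lemma continuousOn_cutoffSlope_mul {n : ℕ} (hU : IsOpen U) (hU_cone : lightCone ⊆ U)
    {g : Spacetime → ℝ} (hg : ContinuousOn g (slab ∩ U)) :
    ContinuousOn (fun p => cutoffSlope n p * g p) slab :=
  contDiffOn_zero.1 (contDiffOn_mul_of_eventuallyEq_zero hU
    (contDiffOn_zero.2 (continuous_cutoffSlope n).continuousOn) (contDiffOn_zero.2 hg) fun _ hp =>
      cutoffSlope_eventuallyEq_zero (lt_of_not_ge fun h => hp.2 (hU_cone ⟨hp.1, h⟩)))

lemma slab_mem_nhds {t : ℝ} (ht : t ∈ Ioo (-1 : ℝ) 0) (x : Euc 2) : slab ∈ 𝓝 (t, x) :=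
  prod_mem_nhds (Ico_mem_nhds ht.1 ht.2) univ_mem

lemma Icc_prod_univ_subset_slab (hT : T < 0) : Icc (-1) T ×ˢ univ ⊆ slab :=
  prod_mono (Icc_subset_Ico_right hT) Subset.rfl

lemma abs_le_norm_of_notMem_closedBall {t : ℝ} (ht : t ∈ Icc (-1) T) (hT : T < 0) {x : Euc 2}
    (hx : x ∉ Metric.closedBall 0 1) : |t| ≤ ‖x‖ := by
  rw [mem_closedBall_zero_iff, not_le] at hx
  exact (abs_le.2 ⟨ht.1, (ht.2.trans hT.le).trans zero_le_one⟩).trans hx.le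

lemma integral_slice_eq_setIntegral_ball {f : Spacetime → ℝ}
    (hf : ∀ p : Spacetime, |p.1| ≤ ‖p.2‖ → f p = 0) (t : ℝ) :
    ∫ x, f (t, x) = ∫ x in Metric.ball 0 |t|, f (t, x) :=
  (setIntegral_eq_integral_of_forall_compl_eq_zero fun x hx =>
    hf (t, x) (le_of_not_gt fun h => hx (mem_ball_zero_iff.2 h))).symm

lemma setIntegral_truncatedCone_divergence {P : Fin 3 → Spacetime → ℝ} {G : Spacetime → ℝ}
    (hP : ∀ α, ContDiffOn ℝ 1 (P α) slab) (hG : ContinuousOn G slab)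
    (hP_zero : ∀ α, ∀ p : Spacetime, |p.1| ≤ ‖p.2‖ → P α p = 0)
    (hG_zero : ∀ p : Spacetime, |p.1| ≤ ‖p.2‖ → G p = 0)
    (h_div : ∀ p, slab ∈ 𝓝 p → ∑ α, minkowski α * fderiv ℝ (P α) p (coordVec α) = G p)
    (hT : T ∈ Ioo (-1) 0) :
    ∫ p in truncatedCone T, G p
      = (∫ x in Metric.ball 0 1, P 0 (-1, x)) - ∫ x in Metric.ball 0 |T|, P 0 (T, x) := by
  have h_slab := Icc_prod_univ_subset_slab hT.2
  have h_interior : Ioo (-1) T ×ˢ univ ⊆ slab :=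
    (Set.prod_mono Ioo_subset_Icc_self Subset.rfl).trans h_slab
  have h_divergence := integral_divergence_eq_sub (μ := volume)
    (isCompact_closedBall (0 : Euc 2) 1) (fun i => EuclideanSpace.single i (1 : ℝ))
    (ρ := fun p => -P 0 p) (j := fun (i : Fin 2) p => P i.succ p) hT.1.le
    ((hP 0).continuousOn.mono h_slab).neg ((hP 0).mono h_interior).neg
    (fun i => (hP i.succ).mono h_interior) (hG.mono h_slab)
    (fun t ht x hx => neg_eq_zero.2 (hP_zero 0 _ (abs_le_norm_of_notMem_closedBall ht hT.2 hx)))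
    (fun i t ht x hx => hP_zero _ _
      (abs_le_norm_of_notMem_closedBall (Ioo_subset_Icc_self ht) hT.2 hx))
    (fun t ht x hx => hG_zero _ (abs_le_norm_of_notMem_closedBall ht hT.2 hx)) fun t ht x => by
      rw [← h_div _ (slab_mem_nhds ⟨ht.1, ht.2.trans hT.2⟩ x), fderiv_fun_neg, Fin.sum_univ_three,
        Fin.sum_univ_two]
      simp [minkowski, coordVec, add_assoc]
  rw [setIntegral_truncatedCone hT.1.le
    (integrableOn_truncatedCone (hG.mono fun p hp => hp.1) hT.2)]
  simp only [← integral_slice_eq_setIntegral_ball hG_zero]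
  rw [h_divergence, integral_neg, integral_neg, integral_slice_eq_setIntegral_ball (hP_zero 0),
    integral_slice_eq_setIntegral_ball (hP_zero 0), abs_neg, abs_one]
  ring

lemma setIntegral_truncatedCone_divergence_cutoff_mul (n : ℕ) (hU : IsOpen U)
    (hU_cone : lightCone ⊆ U) (hJ : ∀ α, ContDiffOn ℝ 1 (J α) (slab ∩ U))
    (hR : ContinuousOn R (slab ∩ U))
    (h_div : ∀ p ∈ U, slab ∈ 𝓝 p → ∑ α, minkowski α * fderiv ℝ (J α) p (coordVec α) = R p)
    (hT : T ∈ Ioo (-1) 0) :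
    ∫ p in truncatedCone T, (cutoff n p * R p - cutoffSlope n p * ∑ α, coord α p * J α p)
      = (∫ x in Metric.ball 0 1, cutoff n (-1, x) * J 0 (-1, x))
        - ∫ x in Metric.ball 0 |T|, cutoff n (T, x) * J 0 (T, x) := by
  refine setIntegral_truncatedCone_divergence (P := fun α p => cutoff n p * J α p)
    (fun α => contDiffOn_cutoff_mul (k := 1) hU hU_cone (hJ α))
    ((contDiffOn_zero.1 (contDiffOn_cutoff_mul hU hU_cone (contDiffOn_zero.2 hR))).sub
      (continuousOn_cutoffSlope_mul hU hU_cone (continuousOn_finsetSum _ fun α _ =>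
        (contDiff_coord (n := 0) α).continuous.continuousOn.mul (hJ α).continuousOn)))
    (fun α p hp => mul_eq_zero_of_left (cutoff_eq_zero hp) _) (fun p hp => ?_)
    (fun p hp => divergence_cutoff_mul_of_divergence_eq hU hU_cone hJ h_div hp) hT
  rw [cutoff_eq_zero hp, cutoffSlope_eq_zero hp, zero_mul, zero_mul, sub_zero]

/-- The energy inequality in the light cone for a current whose flux through the cone is outgoing:
by the divergence theorem for `cutoff n • J`, in which the gradient of the cutoff, being a negative
multiple of the scaling field, contributes with a sign. -/
theorem setIntegral_truncatedCone_le (hU : IsOpen U) (hU_cone : lightCone ⊆ U)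
    (hJ : ∀ α, ContDiffOn ℝ 1 (J α) (slab ∩ U)) (hR : ContinuousOn R (slab ∩ U))
    (h_div : ∀ p ∈ U, slab ∈ 𝓝 p → ∑ α, minkowski α * fderiv ℝ (J α) p (coordVec α) = R p)
    (h_flux : ∀ p ∈ lightCone, ∑ α, coord α p * J α p ≤ 0) (hT : T ∈ Ioo (-1) 0) :
    ∫ p in truncatedCone T, R p
      ≤ (∫ x in Metric.ball 0 1, J 0 (-1, x)) - ∫ x in Metric.ball 0 |T|, J 0 (T, x) := by
  have h_cone : lightCone ⊆ slab ∩ U := fun p hp => ⟨hp.1, hU_cone hp⟩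
  have hR_cone := integrableOn_truncatedCone (hR.mono h_cone) hT.2
  have h_ball := fun t (ht : t ∈ Ico (-1 : ℝ) 0) =>
    integrableOn_slice ((hJ 0).continuousOn.mono h_cone) ht
  have h_cutoff_cont := fun n => (contDiff_cutoff (k := 0) n).continuous
  have h_slice_lim : ∀ t ∈ Ico (-1 : ℝ) 0, Tendsto (fun n : ℕ => ∫ x in Metric.ball 0 |t|,
      cutoff n (t, x) * J 0 (t, x)) atTop (𝓝 (∫ x in Metric.ball 0 |t|, J 0 (t, x))) :=
    fun t ht => tendsto_setIntegral_mul_of_tendsto_one measurableSet_ball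
      (fun n => ((h_cutoff_cont n).comp (by fun_prop : Continuous fun x => (t, x))).measurable)
      (fun n x => abs_cutoff_le_one n (t, x)) (fun x hx => tendsto_cutoff (mem_ball_zero_iff.1 hx))
      (h_ball t ht)
  have h_lim_left := tendsto_setIntegral_mul_of_tendsto_one (measurableSet_truncatedCone T)
    (fun n => (h_cutoff_cont n).measurable) abs_cutoff_le_one (fun p hp => tendsto_cutoff hp.2)
    hR_cone
  have h_lim_initial := h_slice_lim (-1) ⟨le_rfl, by norm_num⟩
  rw [abs_neg, abs_one] at h_lim_initial
  refine le_of_tendsto_of_tendsto' h_lim_left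
    (h_lim_initial.sub (h_slice_lim T (Ioo_subset_Ico_self hT))) fun n => ?_
  rw [← setIntegral_truncatedCone_divergence_cutoff_mul n hU hU_cone hJ hR h_div hT]
  have h_cutoff_R := ((h_cutoff_cont n).continuousOn.mul (hR.mono h_cone))
  have h_slope : ContinuousOn (fun p => cutoffSlope n p * ∑ α, coord α p * J α p) lightCone :=
    (continuous_cutoffSlope n).continuousOn.mul (continuousOn_finsetSum _ fun α _ =>
      (contDiff_coord (n := 0) α).continuous.continuousOn.mul ((hJ α).continuousOn.mono h_cone))
  refine setIntegral_mono_on (integrableOn_truncatedCone h_cutoff_R hT.2)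
    (integrableOn_truncatedCone (h_cutoff_R.sub h_slope) hT.2) (measurableSet_truncatedCone T)
    fun p hp => ?_
  have h_sign := mul_nonpos_of_nonneg_of_nonpos (cutoffSlope_nonneg n p)
    (h_flux p (truncatedCone_subset_lightCone hT.2 hp))
  linarith

end ConeInequality

section StressTensor

variable {F : Type*} [NormedAddCommGroup F] [InnerProductSpace ℝ F]

/-- The squared Minkowski length of a covector `v`, i.e. twice the Lagrangian density of the wave
map equation. -/
def lagrangian (v : Fin 3 → F) : ℝ := ∑ γ, minkowski γ * ‖v γ‖ ^ 2

/-- The components `T_αβ = ⟨v_α, v_β⟩ - η_αβ ⟨v^γ, v_γ⟩ / 2` of the stress-energy tensor. -/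
def stress (v : Fin 3 → F) (α β : Fin 3) : ℝ :=
  inner ℝ (v α) (v β) - if α = β then minkowski α * lagrangian v / 2 else 0

/-- The energy current `X^β T_αβ` of the vector `X`. -/
def current (X : Fin 3 → ℝ) (v : Fin 3 → F) (α : Fin 3) : ℝ := ∑ β, X β * stress v α β

variable {v : Fin 3 → F} {X : Fin 3 → ℝ}

lemma stress_comm (v : Fin 3 → F) (α β : Fin 3) : stress v α β = stress v β α := by
  rcases eq_or_ne α β with rfl | h
  · rfl
  · simp only [stress, if_neg h, if_neg h.symm, real_inner_comm]

lemma current_eq (X : Fin 3 → ℝ) (v : Fin 3 → F) (α : Fin 3) :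
    current X v α
      = inner ℝ (v α) (∑ β, X β • v β) - minkowski α * X α * lagrangian v / 2 := by
  simp only [current, stress, mul_sub, mul_ite, mul_zero, Finset.sum_sub_distrib, inner_sum,
    real_inner_smul_right, Finset.sum_ite_eq, Finset.mem_univ, if_true]
  ring

lemma sum_mul_current (X : Fin 3 → ℝ) (v : Fin 3 → F) :
    ∑ α, X α * current X v α
      = ‖∑ α, X α • v α‖ ^ 2 - (∑ α, minkowski α * X α ^ 2) * lagrangian v / 2 := by
  simp only [current_eq, ← real_inner_self_eq_norm_sq, sum_inner, real_inner_smul_left,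
    Finset.sum_mul, Finset.sum_div, ← Finset.sum_sub_distrib]
  exact Finset.sum_congr rfl fun α _ => by ring

lemma sum_minkowski_mul_stress (v : Fin 3 → F) :
    ∑ α, minkowski α * stress v α α = -(lagrangian v / 2) := by
  simp only [stress, lagrangian, real_inner_self_eq_norm_sq, if_true, Fin.sum_univ_three, minkowski,
    Matrix.cons_val]
  ring

lemma stress_zero_zero (v : Fin 3 → F) : stress v 0 0 = (∑ α, ‖v α‖ ^ 2) / 2 := by
  simp only [stress, lagrangian, real_inner_self_eq_norm_sq, if_true, Fin.sum_univ_three, minkowski,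
    Matrix.cons_val]
  ring

lemma stress_zero_zero_nonneg (v : Fin 3 → F) : 0 ≤ stress v 0 0 := by
  rw [stress_zero_zero]
  positivity

lemma norm_sq_le_two_mul_stress (v : Fin 3 → F) : ‖v 0‖ ^ 2 ≤ 2 * stress v 0 0 := by
  rw [stress_zero_zero, mul_div_cancel₀ _ two_ne_zero]
  exact Finset.single_le_sum (f := fun α => ‖v α‖ ^ 2) (fun α _ => sq_nonneg _)
    (Finset.mem_univ 0)

lemma norm_smul_add_smul_sq_le (a b : ℝ) (u w : F) :
    ‖a • u + b • w‖ ^ 2 ≤ (a ^ 2 + b ^ 2) * (‖u‖ ^ 2 + ‖w‖ ^ 2) := by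
  have h_rotated := sq_nonneg ‖b • u - a • w‖
  rw [norm_sub_sq_real] at h_rotated
  rw [norm_add_sq_real]
  simp only [norm_smul, mul_pow, Real.norm_eq_abs, sq_abs, real_inner_smul_left,
    real_inner_smul_right] at h_rotated ⊢
  linarith

/-- The dominant energy condition for `∂_t` and a causal vector. -/
lemma abs_momentum_le (v : Fin 3 → F) (hX : X 1 ^ 2 + X 2 ^ 2 ≤ X 0 ^ 2) :
    |X 1 * stress v 0 1 + X 2 * stress v 0 2| ≤ |X 0| * stress v 0 0 := by
  have h_momentum : X 1 * stress v 0 1 + X 2 * stress v 0 2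
      = inner ℝ (v 0) (X 1 • v 1 + X 2 • v 2) := by
    simp [stress, inner_add_right, real_inner_smul_right]
  have h_norm : ‖X 1 • v 1 + X 2 • v 2‖ ≤ |X 0| * √(‖v 1‖ ^ 2 + ‖v 2‖ ^ 2) := by
    rw [← Real.sqrt_sq_eq_abs, ← Real.sqrt_mul (sq_nonneg _)]
    exact Real.le_sqrt_of_sq_le ((norm_smul_add_smul_sq_le _ _ _ _).trans
      (mul_le_mul_of_nonneg_right hX (by positivity)))
  have h_am_gm := two_mul_le_add_sq ‖v 0‖ √(‖v 1‖ ^ 2 + ‖v 2‖ ^ 2)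
  rw [Real.sq_sqrt (by positivity)] at h_am_gm
  rw [h_momentum, stress_zero_zero, Fin.sum_univ_three]
  calc |inner ℝ (v 0) (X 1 • v 1 + X 2 • v 2)|
      ≤ ‖v 0‖ * (|X 0| * √(‖v 1‖ ^ 2 + ‖v 2‖ ^ 2)) :=
        (abs_real_inner_le_norm _ _).trans (mul_le_mul_of_nonneg_left h_norm (norm_nonneg _))
    _ = |X 0| * (2 * ‖v 0‖ * √(‖v 1‖ ^ 2 + ‖v 2‖ ^ 2) / 2) := by ring
    _ ≤ |X 0| * ((‖v 0‖ ^ 2 + ‖v 1‖ ^ 2 + ‖v 2‖ ^ 2) / 2) := by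
        refine mul_le_mul_of_nonneg_left ?_ (abs_nonneg _)
        linarith

lemma current_zero_eq (X : Fin 3 → ℝ) (v : Fin 3 → F) :
    current X v 0 = X 0 * stress v 0 0 + (X 1 * stress v 0 1 + X 2 * stress v 0 2) := by
  rw [current, Fin.sum_univ_three, add_assoc]

lemma current_zero_nonpos (v : Fin 3 → F) (hX : X 1 ^ 2 + X 2 ^ 2 ≤ X 0 ^ 2) (hX₀ : X 0 ≤ 0) :
    current X v 0 ≤ 0 := by
  have h := (abs_le.1 (abs_momentum_le v hX)).2
  rw [abs_of_nonpos hX₀] at h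
  rw [current_zero_eq]
  linarith

lemma two_mul_stress_le_current_zero (v : Fin 3 → F) (hX : X 1 ^ 2 + X 2 ^ 2 ≤ X 0 ^ 2)
    (hX₀ : X 0 ≤ 0) : 2 * X 0 * stress v 0 0 ≤ current X v 0 := by
  have h := (abs_le.1 (abs_momentum_le v hX)).1
  rw [abs_of_nonpos hX₀] at h
  rw [current_zero_eq]
  linarith

/-- The dominant energy condition for `X` and its reflection `2 X^0 ∂_t - X`. -/
lemma sum_mul_current_le (v : Fin 3 → F) (hX : X 1 ^ 2 + X 2 ^ 2 ≤ X 0 ^ 2) :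
    ∑ α, X α * current X v α ≤ 2 * X 0 * current X v 0 := by
  have h_norm := norm_smul_add_smul_sq_le (X 1) (X 2) (v 1) (v 2)
  have h_causal := mul_nonneg (sub_nonneg.2 hX) (stress_zero_zero_nonneg v)
  have h_expand : ‖X 0 • v 0 + (X 1 • v 1 + X 2 • v 2)‖ ^ 2 = X 0 ^ 2 * ‖v 0‖ ^ 2
      + 2 * (X 0 * inner ℝ (v 0) (X 1 • v 1 + X 2 • v 2)) + ‖X 1 • v 1 + X 2 • v 2‖ ^ 2 := by
    rw [norm_add_sq_real, norm_smul, mul_pow, Real.norm_eq_abs, sq_abs, real_inner_smul_left]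
  rw [stress_zero_zero, Fin.sum_univ_three] at h_causal
  rw [sum_mul_current, current_eq]
  simp only [lagrangian, Fin.sum_univ_three, minkowski, Matrix.cons_val, add_assoc, h_expand,
    inner_add_right (v 0) (X 0 • v 0), real_inner_smul_right (v 0) (v 0),
    real_inner_self_eq_norm_sq] at h_causal ⊢
  linarith

end StressTensor

section Conservation

variable {F : Type*} [NormedAddCommGroup F] [InnerProductSpace ℝ F] {ψ : Fin 3 → Spacetime → F}
  {D : Fin 3 → Fin 3 → Spacetime → F} {p : Spacetime}

lemma contDiffOn_lagrangian (hψ : ∀ α, ContDiffOn ℝ ∞ (ψ α) slab) :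
    ContDiffOn ℝ ∞ (fun p => lagrangian (ψ · p)) slab :=
  ContDiffOn.sum fun α _ => contDiffOn_const.mul ((hψ α).norm_sq ℝ)

lemma contDiffOn_stress (hψ : ∀ α, ContDiffOn ℝ ∞ (ψ α) slab) (α β : Fin 3) :
    ContDiffOn ℝ ∞ (fun p => stress (ψ · p) α β) slab := by
  refine ((hψ α).inner ℝ (hψ β)).sub ?_
  split_ifs
  · exact (contDiffOn_const.mul (contDiffOn_lagrangian hψ)).div_const 2
  · exact contDiffOn_const

lemma CovariantDivCurl.fderiv_lagrangian (hψ : CovariantDivCurl ψ D) (hp : slab ∈ 𝓝 p)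
    (β : Fin 3) : fderiv ℝ (fun p => lagrangian (ψ · p)) p (coordVec β)
      = 2 * ∑ γ, minkowski γ * inner ℝ (ψ γ p) (D β γ p) := by
  have h_norm : ∀ γ, DifferentiableAt ℝ (fun p => inner ℝ (ψ γ p) (ψ γ p)) p := fun γ =>
    (((hψ.contDiffOn γ).inner ℝ (hψ.contDiffOn γ)).contDiffAt hp).differentiableAt (by simp)
  simp only [lagrangian, ← real_inner_self_eq_norm_sq]
  rw [fderiv_fun_sum fun γ _ => (h_norm γ).const_mul _, sum_apply, Finset.mul_sum]
  refine Finset.sum_congr rfl fun γ _ => ?_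
  rw [fderiv_const_mul (h_norm γ), smul_apply, hψ.fderiv_inner p hp, smul_eq_mul,
    real_inner_comm (ψ γ p)]
  ring

lemma CovariantDivCurl.fderiv_stress (hψ : CovariantDivCurl ψ D) (hp : slab ∈ 𝓝 p)
    (α β γ : Fin 3) : fderiv ℝ (fun p => stress (ψ · p) α β) p (coordVec γ)
      = inner ℝ (D γ α p) (ψ β p) + inner ℝ (ψ α p) (D γ β p)
        - if α = β then minkowski α * ∑ δ, minkowski δ * inner ℝ (ψ δ p) (D γ δ p) else 0 := by
  have h_inner : DifferentiableAt ℝ (fun p => inner ℝ (ψ α p) (ψ β p)) p :=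
    (((hψ.contDiffOn α).inner ℝ (hψ.contDiffOn β)).contDiffAt hp).differentiableAt (by simp)
  have h_lagrangian : DifferentiableAt ℝ (fun p => lagrangian (ψ · p)) p :=
    ((contDiffOn_lagrangian hψ.contDiffOn).contDiffAt hp).differentiableAt (by simp)
  rw [← hψ.fderiv_inner p hp]
  split_ifs with h
  · simp only [stress, if_pos h, mul_div_right_comm]
    rw [fderiv_fun_sub h_inner (h_lagrangian.const_mul _), fderiv_const_mul h_lagrangian,
      sub_apply, smul_apply, hψ.fderiv_lagrangian hp, smul_eq_mul]
    ring
  · simp only [stress, if_neg h, sub_zero]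

lemma CovariantDivCurl.divergence_stress (hψ : CovariantDivCurl ψ D) (hp : slab ∈ 𝓝 p)
    (β : Fin 3) :
    ∑ α, minkowski α * fderiv ℝ (fun p => stress (ψ · p) α β) p (coordVec α) = 0 := by
  have h_div : ∑ α, minkowski α * inner ℝ (D α α p) (ψ β p) = 0 := by
    simpa only [sum_inner, real_inner_smul_left, inner_zero_left]
      using congrArg (inner ℝ · (ψ β p)) (hψ.div p hp)
  simp only [hψ.fderiv_stress hp, mul_sub, mul_add, Finset.sum_sub_distrib,
    Finset.sum_add_distrib, h_div, mul_ite, mul_zero, Finset.sum_ite_eq', Finset.mem_univ, if_true,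
    ← mul_assoc, minkowski_mul_self, one_mul, hψ.curl p hp _ β, zero_add, sub_self]

lemma CovariantDivCurl.divergence_current (hψ : CovariantDivCurl ψ D) (hp : slab ∈ 𝓝 p)
    {X : Spacetime → Fin 3 → ℝ} (hX : ∀ β, DifferentiableAt ℝ (X · β) p) :
    ∑ α, minkowski α * fderiv ℝ (fun p => current (X p) (ψ · p) α) p (coordVec α)
      = ∑ α, ∑ β, minkowski α * fderiv ℝ (X · β) p (coordVec α) * stress (ψ · p) α β := by
  have h_stress : ∀ α β, DifferentiableAt ℝ (fun p => stress (ψ · p) α β) p := fun α β =>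
    ((contDiffOn_stress hψ.contDiffOn α β).contDiffAt hp).differentiableAt (by simp)
  have h_leibniz : ∀ α, minkowski α * fderiv ℝ (fun p => current (X p) (ψ · p) α) p (coordVec α)
      = ∑ β, X p β * (minkowski α * fderiv ℝ (fun p => stress (ψ · p) α β) p (coordVec α))
        + ∑ β, minkowski α * fderiv ℝ (X · β) p (coordVec α) * stress (ψ · p) α β := by
    intro α
    simp only [current]
    rw [fderiv_fun_sum fun β _ => (hX β).fun_mul (h_stress α β), sum_apply, Finset.mul_sum,
      ← Finset.sum_add_distrib]
    refine Finset.sum_congr rfl fun β _ => ?_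
    rw [fderiv_fun_mul (hX β) (h_stress α β), add_apply, smul_apply, smul_apply, smul_eq_mul,
      smul_eq_mul]
    ring
  simp only [h_leibniz, Finset.sum_add_distrib]
  rw [Finset.sum_comm]
  simp only [← Finset.mul_sum, hψ.divergence_stress hp, mul_zero, Finset.sum_const_zero, zero_add]

end Conservation

section Weight

variable {δ : ℝ} {p : Spacetime}

/-- The weight `((1 + δ²) t² - |x|²)^{-1/2}`; `δ` makes it smooth across the light cone. -/
def weight (δ : ℝ) (p : Spacetime) : ℝ := (√(quadForm (1 + δ ^ 2) p))⁻¹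

lemma weight_nonneg (δ : ℝ) (p : Spacetime) : 0 ≤ weight δ p := inv_nonneg.2 (Real.sqrt_nonneg _)

lemma contDiffOn_weight (δ : ℝ) : ContDiffOn ℝ ∞ (weight δ) {p | 0 < quadForm (1 + δ ^ 2) p} :=
  ((contDiff_quadForm _).contDiffOn.sqrt fun _ hp => hp.ne').inv
    fun _ hp => (Real.sqrt_pos.2 hp).ne'

lemma isOpen_quadForm_pos (δ : ℝ) : IsOpen {p | 0 < quadForm (1 + δ ^ 2) p} :=
  isOpen_lt continuous_const (contDiff_quadForm (k := 0) _).continuous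

lemma weight_sq_mul_quadForm (hp : 0 < quadForm (1 + δ ^ 2) p) :
    weight δ p ^ 2 * quadForm (1 + δ ^ 2) p = 1 := by
  rw [weight, inv_pow, Real.sq_sqrt hp.le, inv_mul_cancel₀ hp.ne']

lemma minkowski_mul_fderiv_weight (hp : 0 < quadForm (1 + δ ^ 2) p) (α : Fin 3) :
    minkowski α * fderiv ℝ (weight δ) p (coordVec α)
      = weight δ p ^ 3 * (coord α p + if α = 0 then δ ^ 2 * p.1 else 0) := by
  have h_sqrt := (Real.sqrt_pos.2 hp).ne'
  have h_quad := ((contDiff_quadForm (k := 1) (1 + δ ^ 2)).differentiable one_ne_zero p).hasFDerivAt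
  have h_weight : HasFDerivAt (weight δ) _ p :=
    (hasDerivAt_inv h_sqrt).comp_hasFDerivAt p (h_quad.sqrt hp.ne')
  rw [h_weight.fderiv, smul_apply, smul_apply, fderiv_quadForm, weight, smul_eq_mul, smul_eq_mul]
  fin_cases α <;> simp [minkowski, coord] <;> field_simp

lemma sq_le_quadForm (hp : p ∈ lightCone) : (δ * p.1) ^ 2 ≤ quadForm (1 + δ ^ 2) p := by
  rw [quadForm, mul_pow]
  linarith [norm_sq_le_of_mem_lightCone hp]

lemma quadForm_pos (hδ : 0 < δ) (hp : p ∈ lightCone) : 0 < quadForm (1 + δ ^ 2) p :=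
  (sq_pos_of_ne_zero (mul_ne_zero hδ.ne' (time_neg_of_mem_lightCone hp).ne)).trans_le
    (sq_le_quadForm hp)

lemma abs_mul_weight_le (hδ : 0 < δ) (hp : p ∈ lightCone) : |p.1| * weight δ p ≤ 1 / δ := by
  have h_sqrt : δ * |p.1| ≤ √(quadForm (1 + δ ^ 2) p) :=
    Real.le_sqrt_of_sq_le (by simpa only [mul_pow, sq_abs] using sq_le_quadForm (δ := δ) hp)
  rw [weight, ← div_eq_mul_inv, div_le_div_iff₀ (Real.sqrt_pos.2 (quadForm_pos hδ hp)) hδ]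
  linarith

lemma one_le_two_mul_abs_mul_weight (hδ : 0 < δ) (hδ' : δ ≤ 1) (hp : p ∈ lightCone) :
    1 ≤ 2 * (|p.1| * weight δ p) := by
  have h_sqrt : √(quadForm (1 + δ ^ 2) p) ≤ 2 * |p.1| := by
    refine Real.sqrt_le_iff.2 ⟨by positivity, ?_⟩
    have h_sq := mul_le_mul_of_nonneg_right (pow_le_one₀ hδ.le hδ' : δ ^ 2 ≤ 1) (sq_nonneg p.1)
    rw [quadForm, mul_pow, sq_abs]
    linarith [sq_nonneg ‖p.2‖, sq_nonneg p.1]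
  rw [weight, ← div_eq_mul_inv, ← mul_div_assoc,
    le_div_iff₀ (Real.sqrt_pos.2 (quadForm_pos hδ hp)), one_mul]
  exact h_sqrt

end Weight

section Multiplier

variable {F : Type*} [NormedAddCommGroup F] [InnerProductSpace ℝ F] {ψ : Fin 3 → Spacetime → F}
  {D : Fin 3 → Fin 3 → Spacetime → F} {δ : ℝ} {p : Spacetime}

/-- The components of the vector field `(2 / δ) ∂_t + ((1 + δ²) t² - |x|²)^{-1/2} S`, where
`S = x^α ∂_α`; the first term makes its energy current outgoing through the light cone. -/
def multiplier (δ : ℝ) (p : Spacetime) (β : Fin 3) : ℝ :=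
  (if β = 0 then 2 / δ else 0) + weight δ p * coord β p

/-- The divergence of the energy current of `multiplier δ`. -/
def production (ψ : Fin 3 → Spacetime → F) (δ : ℝ) (p : Spacetime) : ℝ :=
  weight δ p ^ 3 * (‖∑ α, coord α p • ψ α p‖ ^ 2
    + δ ^ 2 * p.1 * inner ℝ (ψ 0 p) (∑ α, coord α p • ψ α p))

lemma current_multiplier (δ : ℝ) (p : Spacetime) (v : Fin 3 → F) (α : Fin 3) :
    current (multiplier δ p) v α = 2 / δ * stress v α 0 + weight δ p * current (coord · p) v α := by
  simp only [current, multiplier, add_mul, ite_mul, zero_mul, Finset.sum_add_distrib,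
    Finset.sum_ite_eq', Finset.mem_univ, if_true, Finset.mul_sum, mul_assoc]

lemma contDiffOn_multiplier (δ : ℝ) (β : Fin 3) :
    ContDiffOn ℝ ∞ (multiplier δ · β) {p | 0 < quadForm (1 + δ ^ 2) p} :=
  contDiffOn_const.add ((contDiffOn_weight δ).mul (contDiff_coord β).contDiffOn)

lemma contDiffOn_current_multiplier (hψ : ∀ α, ContDiffOn ℝ ∞ (ψ α) slab) (δ : ℝ) (α : Fin 3) :
    ContDiffOn ℝ ∞ (fun p => current (multiplier δ p) (ψ · p) α)
      (slab ∩ {p | 0 < quadForm (1 + δ ^ 2) p}) :=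
  ContDiffOn.sum fun β _ => ((contDiffOn_multiplier δ β).mono inter_subset_right).mul
    ((contDiffOn_stress hψ α β).mono inter_subset_left)

lemma continuousOn_production (hψ : ∀ α, ContDiffOn ℝ ∞ (ψ α) slab) (δ : ℝ) :
    ContinuousOn (production ψ δ) (slab ∩ {p | 0 < quadForm (1 + δ ^ 2) p}) := by
  have h_weight := (contDiffOn_weight δ).continuousOn.mono (inter_subset_right (s := slab))
  have hψ' : ∀ α, ContinuousOn (ψ α) (slab ∩ {p | 0 < quadForm (1 + δ ^ 2) p}) :=
    fun α => (hψ α).continuousOn.mono inter_subset_left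
  have h_scaling : ContinuousOn (fun p => ∑ α, coord α p • ψ α p)
      (slab ∩ {p | 0 < quadForm (1 + δ ^ 2) p}) := continuousOn_finsetSum _ fun α _ =>
    (contDiff_coord (n := 0) α).continuous.continuousOn.smul (hψ' α)
  exact (h_weight.pow 3).mul ((h_scaling.norm.pow 2).add
    ((continuousOn_const.mul continuousOn_fst).mul ((hψ' 0).inner h_scaling)))

lemma minkowski_mul_fderiv_multiplier (hp : 0 < quadForm (1 + δ ^ 2) p) (α β : Fin 3) :
    minkowski α * fderiv ℝ (multiplier δ · β) p (coordVec α)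
      = weight δ p ^ 3 * (coord α p + if α = 0 then δ ^ 2 * p.1 else 0) * coord β p
        + if α = β then minkowski α * weight δ p else 0 := by
  have h_weight := ((contDiffOn_weight δ).contDiffAt
    ((isOpen_quadForm_pos δ).mem_nhds hp)).differentiableAt (by simp)
  have h_coord := (contDiff_coord (n := 1) β).differentiable one_ne_zero p
  simp only [multiplier]
  rw [fderiv_const_add, fderiv_fun_mul h_weight h_coord, add_apply, smul_apply, smul_apply,
    fderiv_coord, ← minkowski_mul_fderiv_weight hp, smul_eq_mul, smul_eq_mul]
  split_ifs <;> ring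

lemma sum_minkowski_mul_coord_sq (p : Spacetime) :
    ∑ α, minkowski α * coord α p ^ 2 = -quadForm 1 p := by
  simp only [Fin.sum_univ_three, minkowski, coord, quadForm, Matrix.cons_val,
    EuclideanSpace.real_norm_sq_eq, Fin.sum_univ_two]
  ring

lemma CovariantDivCurl.divergence_current_multiplier (hψ : CovariantDivCurl ψ D)
    (hp : slab ∈ 𝓝 p) (hp' : 0 < quadForm (1 + δ ^ 2) p) :
    ∑ α, minkowski α * fderiv ℝ (fun p => current (multiplier δ p) (ψ · p) α) p (coordVec α)
      = production ψ δ p := by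
  have h_current : ∀ α, ∑ β, minkowski α * fderiv ℝ (multiplier δ · β) p (coordVec α)
        * stress (ψ · p) α β
      = weight δ p ^ 3 * (coord α p * current (coord · p) (ψ · p) α)
        + (if α = 0 then weight δ p ^ 3 * (δ ^ 2 * p.1) * current (coord · p) (ψ · p) α else 0)
        + weight δ p * (minkowski α * stress (ψ · p) α α) := by
    intro α
    simp only [minkowski_mul_fderiv_multiplier hp', add_mul, Finset.sum_add_distrib, mul_add,
      ite_mul, mul_ite, zero_mul, mul_zero, Finset.sum_ite_eq, Finset.mem_univ, if_true, current,
      Finset.mul_sum]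
    split_ifs <;> simp [mul_assoc, mul_left_comm]
  rw [hψ.divergence_current hp fun β => ((contDiffOn_multiplier δ β).contDiffAt
    ((isOpen_quadForm_pos δ).mem_nhds hp')).differentiableAt (by simp)]
  have h_weight := weight_sq_mul_quadForm hp'
  simp only [h_current, Finset.sum_add_distrib, ← Finset.mul_sum, Finset.sum_ite_eq',
    Finset.mem_univ, if_true]
  rw [sum_mul_current, sum_minkowski_mul_coord_sq, sum_minkowski_mul_stress, current_eq, production]
  rw [quadForm] at h_weight ⊢
  rw [show minkowski 0 = -1 from rfl, show coord 0 p = p.1 from rfl]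
  linear_combination (weight δ p * lagrangian (ψ · p) / 2) * h_weight

end Multiplier

section Energy

variable {F : Type*} [NormedAddCommGroup F] [InnerProductSpace ℝ F] {ψ : Fin 3 → Spacetime → F}
  {D : Fin 3 → Fin 3 → Spacetime → F} {δ T : ℝ}

/-- The energy in the slice of the solid light cone at time `t`. -/
def energy (ψ : Fin 3 → Spacetime → F) (t : ℝ) : ℝ :=
  ∫ x in Metric.ball 0 |t|, stress (ψ · (t, x)) 0 0

lemma continuousOn_stress_lightCone (hψ : ∀ α, ContDiffOn ℝ ∞ (ψ α) slab) (α β : Fin 3) :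
    ContinuousOn (fun p => stress (ψ · p) α β) lightCone :=
  (contDiffOn_stress hψ α β).continuousOn.mono fun _ hp => hp.1

lemma CovariantDivCurl.energy_le (hψ : CovariantDivCurl ψ D) (hT : T ∈ Ico (-1) 0) :
    energy ψ T ≤ energy ψ (-1) := by
  rcases hT.1.eq_or_lt with rfl | hT'
  · exact le_rfl
  have h_flux : ∀ p ∈ lightCone, ∑ α, coord α p * stress (ψ · p) α 0 ≤ 0 := fun p hp => by
    simpa only [current, stress_comm _ 0] using current_zero_nonpos (X := (coord · p)) (ψ · p)
      (coord_causal_of_mem_lightCone hp) (time_neg_of_mem_lightCone hp).le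
  have h_cone := setIntegral_truncatedCone_le (R := fun _ => 0) isOpen_univ (subset_univ _)
    (fun α => (((contDiffOn_stress hψ.contDiffOn α 0).of_le (by simp)).mono inter_subset_left))
    continuousOn_const (fun p _ hp => hψ.divergence_stress hp 0) h_flux ⟨hT', hT.2⟩
  rw [integral_zero] at h_cone
  rw [energy, energy, abs_neg, abs_one]
  linarith

lemma sum_coord_mul_current_multiplier_nonpos {p : Spacetime} (hδ : 0 < δ) (hp : p ∈ lightCone)
    (v : Fin 3 → F) : ∑ α, coord α p * current (multiplier δ p) v α ≤ 0 := by
  have h_causal := coord_causal_of_mem_lightCone hp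
  have h_nonpos := current_zero_nonpos v h_causal (time_neg_of_mem_lightCone hp).le
  have h_split : ∑ α, coord α p * current (multiplier δ p) v α
      = 2 / δ * current (coord · p) v 0
        + weight δ p * ∑ α, coord α p * current (coord · p) v α := by
    rw [current]
    simp only [current_multiplier, mul_add, Finset.sum_add_distrib, Finset.mul_sum, stress_comm v 0,
      mul_left_comm]
  have h_weight : 0 ≤ 2 / δ + 2 * (p.1 * weight δ p) := by
    have h_abs := abs_mul_weight_le hδ hp
    rw [abs_of_neg (time_neg_of_mem_lightCone hp)] at h_abs
    linear_combination 2 * h_abs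
  calc ∑ α, coord α p * current (multiplier δ p) v α
      ≤ 2 / δ * current (coord · p) v 0
        + weight δ p * (2 * coord 0 p * current (coord · p) v 0) := by
        rw [h_split]
        gcongr
        · exact weight_nonneg δ p
        · exact sum_mul_current_le v h_causal
    _ = (2 / δ + 2 * (p.1 * weight δ p)) * current (coord · p) v 0 := by
        rw [show coord 0 p = p.1 from rfl]
        ring
    _ ≤ 0 := mul_nonpos_of_nonneg_of_nonpos h_weight h_nonpos

lemma current_multiplier_zero_le {p : Spacetime} (hp : p ∈ lightCone) (v : Fin 3 → F) :
    current (multiplier δ p) v 0 ≤ 2 / δ * stress v 0 0 := by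
  rw [current_multiplier]
  exact add_le_of_nonpos_right (mul_nonpos_of_nonneg_of_nonpos (weight_nonneg δ p)
    (current_zero_nonpos v (coord_causal_of_mem_lightCone hp) (time_neg_of_mem_lightCone hp).le))

lemma current_multiplier_zero_nonneg {p : Spacetime} (hδ : 0 < δ) (hp : p ∈ lightCone)
    (v : Fin 3 → F) : 0 ≤ current (multiplier δ p) v 0 := by
  have h_current := mul_le_mul_of_nonneg_left
    (two_mul_stress_le_current_zero (X := (coord · p)) v (coord_causal_of_mem_lightCone hp)
      (time_neg_of_mem_lightCone hp).le) (weight_nonneg δ p)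
  have h_weight := mul_le_mul_of_nonneg_right (abs_mul_weight_le hδ hp)
    (stress_zero_zero_nonneg v)
  rw [abs_of_neg (time_neg_of_mem_lightCone hp)] at h_weight
  rw [show coord 0 p = p.1 from rfl] at h_current
  rw [current_multiplier]
  linear_combination h_current + 2 * h_weight

theorem CovariantDivCurl.setIntegral_production_le (hψ : CovariantDivCurl ψ D) (hδ : 0 < δ)
    (hT : T ∈ Ioo (-1) 0) :
    ∫ p in truncatedCone T, production ψ δ p ≤ 2 / δ * energy ψ (-1) := by
  have h_cone : lightCone ⊆ {p | 0 < quadForm (1 + δ ^ 2) p} := fun p hp => quadForm_pos hδ hp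
  have h_initial : (-1 : ℝ) ∈ Ico (-1 : ℝ) 0 := ⟨le_rfl, by norm_num⟩
  have h_current := contDiffOn_current_multiplier hψ.contDiffOn δ
  have h_inequality := setIntegral_truncatedCone_le (isOpen_quadForm_pos δ) h_cone
    (fun α => (h_current α).of_le (by simp)) (continuousOn_production hψ.contDiffOn δ)
    (fun p hp hp' => hψ.divergence_current_multiplier hp' hp)
    (fun p hp => sum_coord_mul_current_multiplier_nonpos hδ hp _) hT
  have h_lower : 0 ≤ ∫ x in Metric.ball 0 |T|, current (multiplier δ (T, x)) (ψ · (T, x)) 0 :=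
    setIntegral_nonneg measurableSet_ball fun x hx =>
      current_multiplier_zero_nonneg hδ (mem_lightCone_of_mem_ball (Ioo_subset_Ico_self hT) hx) _
  have h_upper : ∫ x in Metric.ball 0 |(-1)|, current (multiplier δ (-1, x)) (ψ · (-1, x)) 0
      ≤ 2 / δ * energy ψ (-1) := by
    rw [energy, ← integral_const_mul]
    exact setIntegral_mono_on
      (integrableOn_slice ((h_current 0).continuousOn.mono fun p hp => ⟨hp.1, h_cone hp⟩) h_initial)
      ((integrableOn_slice (continuousOn_stress_lightCone hψ.contDiffOn 0 0) h_initial).const_mul _)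
      measurableSet_ball fun x hx =>
        current_multiplier_zero_le (mem_lightCone_of_mem_ball h_initial hx) _
  rw [abs_neg, abs_one] at h_upper
  linarith

lemma continuousOn_stress_div (hψ : ∀ α, ContDiffOn ℝ ∞ (ψ α) slab) :
    ContinuousOn (fun p => stress (ψ · p) 0 0 / -p.1) lightCone :=
  (continuousOn_stress_lightCone hψ 0 0).div continuousOn_fst.neg fun _ hp =>
    (neg_pos.2 (time_neg_of_mem_lightCone hp)).ne'

lemma CovariantDivCurl.setIntegral_stress_div_le (hψ : CovariantDivCurl ψ D)
    (hT : T ∈ Ioo (-1) 0) :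
    ∫ p in truncatedCone T, stress (ψ · p) 0 0 / -p.1 ≤ energy ψ (-1) * |Real.log (|T|)| := by
  have h_subset : Icc (-1) T ⊆ Ico (-1) 0 := Icc_subset_Ico_right hT.2
  have h_integrable : IntervalIntegrable (fun t => energy ψ (-1) * -t⁻¹) volume (-1) T :=
    ContinuousOn.intervalIntegrable_of_Icc hT.1.le
      (continuousOn_const.mul (continuousOn_id.inv₀ fun t ht => (h_subset ht).2.ne).neg)
  have h_log : ∫ t in (-1)..T, energy ψ (-1) * -t⁻¹ = energy ψ (-1) * |Real.log (|T|)| := by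
    have h_neg : Real.log |T| ≤ 0 :=
      Real.log_nonpos (abs_nonneg T) (abs_le.2 ⟨hT.1.le, hT.2.le.trans zero_le_one⟩)
    rw [intervalIntegral.integral_const_mul, intervalIntegral.integral_neg,
      integral_inv_of_neg neg_one_lt_zero hT.2, abs_of_nonpos h_neg, Real.log_abs, div_neg, div_one,
      Real.log_neg_eq_log]
  rw [setIntegral_truncatedCone hT.1.le
    (integrableOn_truncatedCone (continuousOn_stress_div hψ.contDiffOn) hT.2), ← h_log]
  have h_slice : ∀ t, ∫ x in Metric.ball 0 |t|, stress (ψ · (t, x)) 0 0 / -t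
      = energy ψ t * -t⁻¹ := fun t => by
    rw [energy, integral_div, div_eq_mul_inv, inv_neg]
  simp only [h_slice]
  rw [intervalIntegral.integral_of_le hT.1.le, intervalIntegral.integral_of_le hT.1.le]
  have h_inv : ∀ t ∈ Ioc (-1) T, 0 ≤ -t⁻¹ := fun t ht =>
    neg_nonneg.2 (inv_nonpos.2 (ht.2.trans hT.2.le))
  refine integral_mono_of_nonneg
    (ae_restrict_of_forall_mem measurableSet_Ioc fun t ht => mul_nonneg ?_ (h_inv t ht))
    h_integrable.1 (ae_restrict_of_forall_mem measurableSet_Ioc fun t ht =>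
      mul_le_mul_of_nonneg_right (hψ.energy_le (h_subset (Ioc_subset_Icc_self ht))) (h_inv t ht))
  exact integral_nonneg fun x => stress_zero_zero_nonneg _

end Energy

section ScalingDensity

variable {m : ℕ} {ψ : Fin 3 → Spacetime → Euc m} {D : Fin 3 → Fin 3 → Spacetime → Euc m}
  {δ T : ℝ} {p : Spacetime}

lemma scalingComponent_eq_sum (ψ : Fin 3 → Spacetime → Euc m) (p : Spacetime) :
    scalingComponent ψ p = ∑ α, coord α p • ψ α p := by
  rw [Fin.sum_univ_three]
  rfl

/-- The density `t⁻¹ |t⁻¹ ψ_S|²`, which is nonpositive because `t < 0` on the slab. -/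
def scalingDensity (ψ : Fin 3 → Spacetime → Euc m) (p : Spacetime) : ℝ :=
  ‖(1 / p.1) • scalingComponent ψ p‖ ^ 2 / p.1

lemma scalingDensity_nonpos (ψ : Fin 3 → Spacetime → Euc m) (hp : p ∈ lightCone) :
    scalingDensity ψ p ≤ 0 :=
  div_nonpos_of_nonneg_of_nonpos (sq_nonneg _) (time_neg_of_mem_lightCone hp).le

lemma continuousOn_scalingDensity (hψ : ∀ α, ContDiffOn ℝ ∞ (ψ α) slab) :
    ContinuousOn (scalingDensity ψ) lightCone := by
  have h_scaling : ContinuousOn (scalingComponent ψ) lightCone := by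
    simp only [funext (scalingComponent_eq_sum ψ)]
    exact continuousOn_finsetSum _ fun α _ =>
      (contDiff_coord (n := 0) α).continuous.continuousOn.smul
        ((hψ α).continuousOn.mono fun _ hp => hp.1)
  have h_time : ∀ p ∈ lightCone, p.1 ≠ 0 := fun p hp => (time_neg_of_mem_lightCone hp).ne
  exact (((continuousOn_const.div continuousOn_fst h_time).smul h_scaling).norm.pow 2).div
    continuousOn_fst h_time

lemma le_production (ψ : Fin 3 → Spacetime → Euc m) (δ : ℝ) (p : Spacetime) :
    weight δ p ^ 3 * (‖scalingComponent ψ p‖ ^ 2 / 2 - δ ^ 4 * p.1 ^ 2 * stress (ψ · p) 0 0)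
      ≤ production ψ δ p := by
  have h_square := sq_nonneg ‖scalingComponent ψ p + (δ ^ 2 * p.1) • ψ 0 p‖
  rw [norm_add_sq_real, norm_smul, mul_pow, Real.norm_eq_abs, sq_abs, real_inner_smul_right,
    real_inner_comm] at h_square
  have h_stress := mul_le_mul_of_nonneg_left (norm_sq_le_two_mul_stress (ψ · p))
    (sq_nonneg (δ ^ 2 * p.1))
  rw [production, ← scalingComponent_eq_sum]
  refine mul_le_mul_of_nonneg_left ?_ (pow_nonneg (weight_nonneg δ p) 3)
  linear_combination h_square / 2 + h_stress / 2

lemma neg_scalingDensity_le (ψ : Fin 3 → Spacetime → Euc m) (hδ : 0 < δ) (hδ' : δ ≤ 1)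
    (hp : p ∈ lightCone) :
    -scalingDensity ψ p ≤ 16 * (production ψ δ p + δ * (stress (ψ · p) 0 0 / -p.1)) := by
  have h_neg := time_neg_of_mem_lightCone hp
  have h_ne := h_neg.ne
  have h_time : 0 < -p.1 := neg_pos.2 h_neg
  have h_weight := mul_nonneg h_time.le (weight_nonneg δ p)
  have h_le : δ ^ 4 * (-p.1 * weight δ p) ^ 3 ≤ δ := by
    have h_abs := abs_mul_weight_le hδ hp
    rw [abs_of_neg h_neg] at h_abs
    calc δ ^ 4 * (-p.1 * weight δ p) ^ 3 ≤ δ ^ 4 * (1 / δ) ^ 3 := by gcongr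
      _ = δ := by field_simp
  have h_ge : 1 ≤ 8 * (-p.1 * weight δ p) ^ 3 := by
    have h_abs := one_le_two_mul_abs_mul_weight hδ hδ' hp
    rw [abs_of_neg h_neg] at h_abs
    exact (one_le_pow₀ h_abs (n := 3)).trans_eq (by ring)
  have h_scaling := le_mul_of_one_le_left (sq_nonneg ‖scalingComponent ψ p‖) h_ge
  have h_stress := mul_nonneg (mul_nonneg (sub_nonneg.2 h_le) (sq_nonneg p.1))
    (stress_zero_zero_nonneg (ψ · p))
  calc -scalingDensity ψ p = ‖scalingComponent ψ p‖ ^ 2 / (-p.1) ^ 3 := by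
        rw [scalingDensity, norm_smul, mul_pow, Real.norm_eq_abs, sq_abs]
        field_simp
    _ ≤ (8 * (-p.1 * weight δ p) ^ 3 * ‖scalingComponent ψ p‖ ^ 2 + 16 *
          ((δ - δ ^ 4 * (-p.1 * weight δ p) ^ 3) * p.1 ^ 2 * stress (ψ · p) 0 0)) / (-p.1) ^ 3 := by
        gcongr
        linarith
    _ = 16 * (weight δ p ^ 3 * (‖scalingComponent ψ p‖ ^ 2 / 2
          - δ ^ 4 * p.1 ^ 2 * stress (ψ · p) 0 0) + δ * (stress (ψ · p) 0 0 / -p.1)) := by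
        field_simp
        ring
    _ ≤ 16 * (production ψ δ p + δ * (stress (ψ · p) 0 0 / -p.1)) := by
        gcongr
        exact le_production ψ δ p

theorem CovariantDivCurl.neg_setIntegral_scalingDensity_le (hψ : CovariantDivCurl ψ D)
    (hδ : 0 < δ) (hδ' : δ ≤ 1) (hT : T ∈ Ioo (-1) 0) :
    -∫ p in truncatedCone T, scalingDensity ψ p
      ≤ 16 * energy ψ (-1) * (2 / δ + δ * |Real.log (|T|)|) := by
  have h_cone : lightCone ⊆ slab ∩ {p | 0 < quadForm (1 + δ ^ 2) p} :=
    fun p hp => ⟨hp.1, quadForm_pos hδ hp⟩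
  have h_production := integrableOn_truncatedCone
    ((continuousOn_production hψ.contDiffOn δ).mono h_cone) hT.2
  have h_stress := (integrableOn_truncatedCone
    (continuousOn_stress_div hψ.contDiffOn) hT.2).const_mul δ
  calc -∫ p in truncatedCone T, scalingDensity ψ p
      ≤ ∫ p in truncatedCone T, 16 * (production ψ δ p + δ * (stress (ψ · p) 0 0 / -p.1)) := by
        rw [← integral_neg]
        exact setIntegral_mono_on
          (integrableOn_truncatedCone (continuousOn_scalingDensity hψ.contDiffOn) hT.2).neg
          ((h_production.add h_stress).const_mul 16) (measurableSet_truncatedCone T)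
          fun p hp => neg_scalingDensity_le ψ hδ hδ' (truncatedCone_subset_lightCone hT.2 hp)
    _ = 16 * ((∫ p in truncatedCone T, production ψ δ p)
          + δ * ∫ p in truncatedCone T, stress (ψ · p) 0 0 / -p.1) := by
        rw [integral_const_mul, integral_add h_production h_stress, integral_const_mul]
    _ ≤ 16 * (2 / δ * energy ψ (-1) + δ * (energy ψ (-1) * |Real.log (|T|)|)) := by
        gcongr
        · exact hψ.setIntegral_production_le hδ hT
        · exact hψ.setIntegral_stress_div_le hT
    _ = 16 * energy ψ (-1) * (2 / δ + δ * |Real.log (|T|)|) := by ring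

lemma CovariantDivCurl.abs_average_scalingDensity_le (hψ : CovariantDivCurl ψ D)
    (hT : T ∈ Ioo (-1) 0) (hT_log : 1 ≤ |Real.log (|T|)|) :
    |1 / |Real.log (|T|)| * ∫ p in truncatedCone T, scalingDensity ψ p|
      ≤ 48 * energy ψ (-1) * (√|Real.log (|T|)|)⁻¹ := by
  have h_nonpos : ∫ p in truncatedCone T, scalingDensity ψ p ≤ 0 :=
    setIntegral_nonpos (measurableSet_truncatedCone T) fun p hp =>
      scalingDensity_nonpos ψ (truncatedCone_subset_lightCone hT.2 hp)
  have h_sqrt : 1 ≤ √|Real.log (|T|)| := Real.one_le_sqrt.2 hT_log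
  -- `δ = |log |T||^{-1/2}` balances the two terms of the bound.
  have h_bound := hψ.neg_setIntegral_scalingDensity_le (inv_pos.2 (one_pos.trans_le h_sqrt))
    (inv_le_one_of_one_le₀ h_sqrt) hT
  rw [abs_mul, abs_of_nonpos h_nonpos, abs_of_nonneg (by positivity)]
  refine (mul_le_mul_of_nonneg_left h_bound (by positivity)).trans_eq ?_
  have h_sq := Real.mul_self_sqrt (abs_nonneg (Real.log |T|))
  have h_pos := one_pos.trans_le h_sqrt
  generalize √|Real.log (|T|)| = s at h_sq h_pos
  rw [← h_sq]
  field_simp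
  ring

theorem CovariantDivCurl.tendsto_average_scalingDensity (hψ : CovariantDivCurl ψ D) :
    Tendsto (fun T => 1 / |Real.log (|T|)| * ∫ p in truncatedCone T, scalingDensity ψ p)
      (𝓝[<] 0) (𝓝 0) := by
  have h_log : Tendsto (fun T : ℝ => |Real.log (|T|)|) (𝓝[<] 0) atTop := by
    simpa only [Real.log_abs, Function.comp_def] using
      tendsto_abs_atBot_atTop.comp Real.tendsto_log_nhdsLT_zero
  have h_bound : Tendsto (fun T : ℝ => 48 * energy ψ (-1) * (√|Real.log (|T|)|)⁻¹)
      (𝓝[<] 0) (𝓝 0) := by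
    simpa only [mul_zero, Function.comp_def] using (tendsto_inv_atTop_zero.comp
      (Real.tendsto_sqrt_atTop.comp h_log)).const_mul (48 * energy ψ (-1))
  refine squeeze_zero_norm' ?_ h_bound
  filter_upwards [h_log.eventually_ge_atTop 1, Ioo_mem_nhdsLT neg_one_lt_zero] with T hT_log hT
  exact hψ.abs_average_scalingDensity_le hT hT_log

lemma setIntegral_scalingDensity (hψ : ∀ α, ContDiffOn ℝ ∞ (ψ α) slab) (hT : T ∈ Ioo (-1) 0) :
    ∫ p in truncatedCone T, scalingDensity ψ p = ∫ t in (-1)..T,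
      (∫ x in Metric.ball (0 : Euc 2) |t|, ‖(1 / t) • scalingComponent ψ (t, x)‖ ^ 2) / t := by
  rw [setIntegral_truncatedCone hT.1.le
    (integrableOn_truncatedCone (continuousOn_scalingDensity hψ) hT.2)]
  simp only [scalingDensity, integral_div]

end ScalingDensity

end WaveMap

end

theorem proposition3p1_general {m : ℕ} {N : Type*} [TopologicalSpace N]
    [ChartedSpace (WaveMap.Euc m) N] [IsManifold (𝓡 m) ∞ N] {h : WaveMap.RiemMetric m N}
    {φ : WaveMap.Spacetime → N} {e : Fin m → ∀ p, TangentSpace (𝓡 m) (φ p)}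
    {A : Fin 3 → WaveMap.Spacetime → Matrix (Fin m) (Fin m) ℝ}
    {ψ : Fin 3 → WaveMap.Spacetime → WaveMap.Euc m}
    (hψ : WaveMap.IsDerivativeWaveMap h φ e A ψ) :
    (∀ T ∈ Ioo (-1 : ℝ) 0,
      IntegrableOn
        (fun p : WaveMap.Spacetime => ‖(1 / p.1) • WaveMap.scalingComponent ψ p‖ ^ 2 / p.1)
        {p : WaveMap.Spacetime | p.1 ∈ Icc (-1 : ℝ) T ∧ ‖p.2‖ < |p.1|}) ∧
    Tendsto
      (fun T : ℝ => (1 / |Real.log (|T|)|) *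
        ∫ t in (-1 : ℝ)..T,
          (∫ x in Metric.ball (0 : WaveMap.Euc 2) |t|,
            ‖(1 / t) • WaveMap.scalingComponent ψ (t, x)‖ ^ 2) / t)
      (𝓝[<] 0) (𝓝 0) := by
  have h_divCurl := hψ.covariantDivCurl
  refine ⟨fun T hT => WaveMap.integrableOn_truncatedCone
    (WaveMap.continuousOn_scalingDensity h_divCurl.contDiffOn) hT.2,
    h_divCurl.tendsto_average_scalingDensity.congr' ?_⟩
  filter_upwards [Ioo_mem_nhdsLT neg_one_lt_zero] with T hT
  rw [WaveMap.setIntegral_scalingDensity h_divCurl.contDiffOn hT]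

theorem proposition3p1 {m : ℕ} {N : Type*} [TopologicalSpace N]
    [ChartedSpace (WaveMap.Euc m) N] [IsManifold (𝓡 m) ∞ N] (h : WaveMap.RiemMetric m N)
    (ψ : Fin 3 → WaveMap.Spacetime → WaveMap.Euc m)
    (hψ : WaveMap.IsSchwartzDerivativeWaveMap h ψ) :
    (∀ T ∈ Ioo (-1 : ℝ) 0,
      IntegrableOn
        (fun p : WaveMap.Spacetime => ‖(1 / p.1) • WaveMap.scalingComponent ψ p‖ ^ 2 / p.1)
        {p : WaveMap.Spacetime | p.1 ∈ Icc (-1 : ℝ) T ∧ ‖p.2‖ < |p.1|}) ∧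
    Tendsto
      (fun T : ℝ => (1 / |Real.log (|T|)|) *
        ∫ t in (-1 : ℝ)..T,
          (∫ x in Metric.ball (0 : WaveMap.Euc 2) |t|,
            ‖(1 / t) • WaveMap.scalingComponent ψ (t, x)‖ ^ 2) / t)
      (𝓝[<] 0) (𝓝 0) := by
  obtain ⟨φ, e, A, hφ, he, h_mapDeriv, h_covDeriv, h_wave⟩ := hψ
  exact proposition3p1_general ⟨hφ.1, he, h_mapDeriv, h_covDeriv, h_wave⟩
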